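/- **Theorem (SQ lower bound for multiclass linear classification with RCN).** Conventions. For $K\ge 2$ write $[K]$ for the set of labels. A $K$-class linear classifier on $\mathbb{R}^d$ is a function $f(\mathbf{x})=\operatorname{argmax}_{i\in[K]}(\mathbf{w}^{(i)}\cdot\mathbf{x}+t_i)$ with $\mathbf{w}^{(i)}\in\mathbb{R}^d$, $t_i\in\mathbb{R}$ (ties resolved by the smallest index); $\mathcal{L}_{d,K}$ is the class of these. For $\gamma>0$, let $\mathcal{I}_{d,K,\gamma}$ be the set of probability distributions $D$ of $(\mathbf{x},y)\in\mathbb{R}^d\times[K]$ such that $\mathbf{x}\sim\mathcal{N}(\mathbf{0},\mathbf{I})$ and there are $f\in\mathcal{L}_{d,K}$ and a row-stochastic matrix $\mathbf{H}\in\mathbb{R}^{K\times K}$ with $\mathbf{H}_{i,i}>\mathbf{H}_{i,j}+\gamma$ for all $i\ne j$ and $\Pr_D[y=i\mid\mathbf{x}]=\mathbf{H}_{f(\mathbf{x}),i}$ (random classification noise with separation $\gamma$). Put $\mathrm{OPT}(D)=\inf_{f\in\mathcal{L}_{d,K}}\Pr_D[f(\mathbf{x})\ne y]$. A valid oracle for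 $D$ is a fixed function that, for all $u>0$, answers as a $\mathrm{VSTAT}(u)$ oracle: it answers each measurable query $q:\mathbb{R}^d\times[K]\to[-1,1]$ with a value $v$ such that $|v-\mathbf{E}_D[q]|\le\max\big(1/u,\sqrt{\mathrm{Var}_D[q]/u}\big)$. A (randomized) SQ algorithm draws a random seed, then adaptively makes finitely many queries, each with a parameter $u$ of its choice, and outputs a measurable hypothesis $h:\mathbb{R}^d\to[K]$. It learns $\mathcal{L}_{d,K}$ under RCN with separation $\gamma$ to error $\mathrm{OPT}+\epsilon$ if for every $D\in\mathcal{I}_{d,K,\gamma}$ and every valid oracle for $D$, with probability at least $2/3$ over the seed, $\Pr_D[h(\mathbf{x})\ne y]\le\mathrm{OPT}(D)+\epsilon$. Statement. There is a universal constant $C$ such that for every $\delta\in(0,1)$ there are $a,c>0$ and $d_0$, depending only on $\delta$, for which the following holds. Let $d\ge d_0$, $2\le K\le d^{1-\delta}$, $0<\gamma\le K^{-C}$ and $0<\epsilon\le K^{-C}$. Then every SQ algorithm that learns $\mathcal{L}_{d,K}$ under RCN with separation $\gamma$ to error $\mathrm{OPT}+\epsilon$ must, for some $D\in\mathcal{I}_{d,K,\gamma}$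 and some valid oracle for $D$, with positive probability make at least $2^{d^{a}}$ queries or at least one query to $\mathrm{VSTAT}(u)$ with $u\ge d^{cK}$. (In particular this holds for every algorithm that succeeds for all separations $\gamma>0$.) -/

import Mathlib

open MeasureTheory ProbabilityTheory

noncomputable section

namespace SQRCN

/-! ### Statistical queries and SQ algorithms -/

/-- A statistical query on `X`, addressed to the oracle `VSTAT(u)`: a (measurable) function
`X → [-1, 1]` together with the parameter `u > 0`. -/
structure Query (X : Type*) [MeasurableSpace X] where
  /-- the query function -/
  fn : X → ℝ
  measurable_fn : Measurable fn
  bounded_fn : ∀ x, fn x ∈ Set.Icc (-1 : ℝ) 1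
  /-- the parameter of the `VSTAT` oracle that is called -/
  u : ℝ
  u_pos : 0 < u

/-- The tolerance `max (1/u, √(Var_D[q] / u))` with which `VSTAT(u)` answers `q` on `D`. -/
def Query.tolerance {X : Type*} [MeasurableSpace X] (q : Query X) (D : Measure X) : ℝ :=
  max (1 / q.u) (Real.sqrt (variance q.fn D / q.u))

/-- `O` is a valid VSTAT oracle for the distribution `D`: every query gets an answer that is
within the tolerance of the true expectation. -/
def IsVSTAT {X : Type*} [MeasurableSpace X] (O : Query X → ℝ) (D : Measure X) : Prop :=
  ∀ q : Query X, |O q - ∫ x, q.fn x ∂D| ≤ q.tolerance D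

/-- A deterministic adaptive SQ algorithm with outputs in `Y`, as a decision tree: either it stops
with an output, or it makes a query and continues in a way that depends on the answer. -/
inductive SQAlg (X : Type*) [MeasurableSpace X] (Y : Type*) where
  | output (y : Y) : SQAlg X Y
  | query (q : Query X) (next : ℝ → SQAlg X Y) : SQAlg X Y

/-- The output of the algorithm when its queries are answered by `O`. -/
def SQAlg.result {X : Type*} [MeasurableSpace X] {Y : Type*} (O : Query X → ℝ) :
    SQAlg X Y → Y
  | .output y => y
  | .query q next => (next (O q)).result O

/-- The list of the queries that the algorithm makes when they are answered by `O`. -/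
def SQAlg.queries {X : Type*} [MeasurableSpace X] {Y : Type*} (O : Query X → ℝ) :
    SQAlg X Y → List (Query X)
  | .output _ => []
  | .query q next => q :: (next (O q)).queries O

/-! ### Multiclass linear classifiers and random classification noise -/

/-- The class of `K`-class linear classifiers on `ℝ^d`:
`f x = argmax_i (w i · x + t i)`, ties resolved by the smallest index. -/
def linearClassifiers (d K : ℕ) : Set (EuclideanSpace ℝ (Fin d) → Fin K) :=
  {f | ∃ (w : Fin K → EuclideanSpace ℝ (Fin d)) (t : Fin K → ℝ), ∀ x,
    (∀ j, inner ℝ (w j) x + t j ≤ inner ℝ (w (f x)) x + t (f x)) ∧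
    (∀ j, j < f x → inner ℝ (w j) x + t j < inner ℝ (w (f x)) x + t (f x))}

/-- `D` is an RCN distribution for the class `F` with separation `γ`: for some `f ∈ F` and some
row-stochastic confusion matrix `H` with `H i i > H i j + γ` for `j ≠ i`, one has
`Pr_D[y = i | x] = H (f x) i`. -/
def IsRCN {X : Type*} [MeasurableSpace X] {K : ℕ} (F : Set (X → Fin K)) (γ : ℝ)
    (D : Measure (X × Fin K)) : Prop :=
  ∃ f ∈ F, ∃ H ∈ Matrix.rowStochastic ℝ (Fin K),
    (∀ i j, j ≠ i → H i j + γ < H i i) ∧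
    ∀ (i : Fin K) (A : Set X), MeasurableSet A →
      D (A ×ˢ {i}) = ∫⁻ x in A, ENNReal.ofReal (H (f x) i) ∂D.fst

/-- The 0-1 error `Pr_{(x,y) ∼ D}[h x ≠ y]`. -/
def err {X : Type*} [MeasurableSpace X] {K : ℕ} (D : Measure (X × Fin K)) (h : X → Fin K) :
    ENNReal :=
  D {p | h p.1 ≠ p.2}

/-- `OPT = inf_{f ∈ F} Pr_{(x,y) ∼ D}[f x ≠ y]`. -/
def opt {X : Type*} [MeasurableSpace X] {K : ℕ} (F : Set (X → Fin K))
    (D : Measure (X × Fin K)) : ENNReal :=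
  ⨅ f ∈ F, err D f

/-- Labelled examples `(x, y) ∈ ℝ^d × [K]`. -/
abbrev Example (d K : ℕ) : Type := EuclideanSpace ℝ (Fin d) × Fin K

/-- Hypotheses: measurable functions `ℝ^d → [K]`. -/
abbrev Hypothesis (d K : ℕ) : Type := {h : EuclideanSpace ℝ (Fin d) → Fin K // Measurable h}

/-- The admissible input distributions: probability distributions on `ℝ^d × [K]` with standard
Gaussian `x`-marginal, that are RCN distributions with separation `γ` for the `K`-class linear
classifiers. -/
def IsInput (d K : ℕ) (γ : ℝ) (D : Measure (Example d K)) : Prop :=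
  IsProbabilityMeasure D ∧
    D.fst = stdGaussian (EuclideanSpace ℝ (Fin d)) ∧
    IsRCN (linearClassifiers d K) γ D

/-- The randomized SQ algorithm `A` (a deterministic algorithm `A ω` for each random seed `ω ∼ P`)
learns `K`-class linear classifiers under the standard Gaussian with RCN of separation `γ` to error
`OPT + ε`: for every admissible `D` and every valid oracle for `D`, it fails with probability at
most `1/3`. For a set that is not measurable, `P` is the outer measure, so that no measurability
in `ω` is needed. -/
def Learns {Ω : Type*} [MeasurableSpace Ω] (P : Measure Ω) (d K : ℕ) (γ ε : ℝ)
    (A : Ω → SQAlg (Example d K) (Hypothesis d K)) : Prop :=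
  ∀ D : Measure (Example d K), IsInput d K γ D →
    ∀ O : Query (Example d K) → ℝ, IsVSTAT O D →
      P {ω | ¬ err D ((A ω).result O).1 ≤
        opt (linearClassifiers d K) D + ENNReal.ofReal ε} ≤ 1 / 3

end SQRCN

end

namespace SQRCN

/-! ### Correlations and statistical queries -/

/-! The hard inputs have a hidden direction. For a unit vector v the label depends on x only through
z = v·x: equally spaced thresholds cut the line into K cells, F z is the cell of z, and the
confusion matrix is (1 + E/6)/K, a perturbation of the uniform one. Suppose that each function z ↦ E
(F z) j is Gaussian-orthogonal to all polynomials of degree < n. Then, relative to uniform labels,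
the perturbations for directions with |v·w| ≤ r have correlation O((4r)^n)
(`abs_integral_mul_inner_inner_le`). With r = d^(-δ/4) there are about exp(d r²/2) directions whose
pairwise inner products are at most r (`exists_almost_orthogonal`).

If n is proportional to K, these correlations are d^(-Ω(δK)), and an SQ-dimension argument applies.
A query to VSTAT(u) with u < d^(cK) separates at most 2u of the inputs from the null distribution
(`card_distinguished_le`). Oracles that give the null expectation whenever this is a legal answer
therefore lead a run with few queries to one and the same hypothesis for most directions
(`exists_common_result`), while a single hypothesis is almost optimal for only O(K²) of them
(`card_le_of_correlation`).

The heart is an E with n proportional to K. Let A ⊆ ℝ^K consist of the vectors of cell integrals of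
polynomials of degree < n, and let P be the orthogonal projection onto A. The columns of I − P are
orthogonal to A, which is the moment condition; subtracting from each row its mean makes the row
sums vanish and keeps this orthogonality. The diagonal dominates once ‖P e_i‖² ≤ 1/8 for all i, that
is, once no vector of A has more than an eighth of its squared norm in one coordinate
(`exists_isMomentMatching_of_leverage`).

This is a sampling inequality. For p of degree ≤ k the function q = p·exp(-x²/2) satisfies ‖q'‖² ≤
(2k+1)‖q‖² and has little mass beyond |x| of order √k. On cells of width a small multiple of 1/√k it
is nearly constant in the mean square sense, so its cell integrals determine ‖q‖, while a single
cell contributes little (`leverage_cell`). Such a grid needs only O(k) cells. -/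

theorem integrable_mul_of_memLp_two {X : Type*} [MeasurableSpace X] {μ : Measure X} {f g : X → ℝ}
    (hf : MemLp f 2 μ) (hg : MemLp g 2 μ) : Integrable (fun x => f x * g x) μ :=
  hf.integrable_mul hg

/-- Cauchy–Schwarz, from the discriminant of the nonnegative quadratic t ↦ ∫ (f + t g)². -/
theorem sq_integral_mul_le {X : Type*} [MeasurableSpace X] {μ : Measure X} {f g : X → ℝ}
    (hf : MemLp f 2 μ) (hg : MemLp g 2 μ) :
    (∫ x, f x * g x ∂μ) ^ 2 ≤ (∫ x, f x ^ 2 ∂μ) * ∫ x, g x ^ 2 ∂μ := by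
  have hff := hf.integrable_sq
  have hgg := hg.integrable_sq
  have hfg : Integrable (fun x => f x * g x) μ := hf.integrable_mul hg
  have key : ∀ t : ℝ, 0 ≤ (∫ x, g x ^ 2 ∂μ) * (t * t) + (2 * ∫ x, f x * g x ∂μ) * t
      + ∫ x, f x ^ 2 ∂μ := by
    intro t
    have h : 0 ≤ ∫ x, (f x + t * g x) ^ 2 ∂μ := integral_nonneg fun x => sq_nonneg _
    have e : (fun x => (f x + t * g x) ^ 2)
        = fun x => f x ^ 2 + (2 * t) * (f x * g x) + t ^ 2 * g x ^ 2 := by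
      funext x; ring
    have h1 : Integrable (fun x => (2 * t) * (f x * g x)) μ := hfg.const_mul _
    have h2 : Integrable (fun x => f x ^ 2 + (2 * t) * (f x * g x)) μ := hff.add h1
    rw [e, integral_add h2 (hgg.const_mul _), integral_add hff h1, integral_const_mul,
      integral_const_mul] at h
    linarith
  have := discrim_le_zero key
  rw [discrim] at this
  nlinarith

/-- Few of several almost uncorrelated functions correlate well with a given function. -/
theorem card_mul_le_of_correlated {X ι : Type*} [MeasurableSpace X] {μ : Measure X}
    {g : ι → X → ℝ} {τ β t : ℝ} (hg : ∀ i, MemLp (g i) 2 μ) (hβ : 0 ≤ β) (hdiag : ∀ i, ∫ x, g i x ^ 2 ∂μ ≤ β) (hτ : 0 ≤ τ)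
    (hoff : ∀ i j, i ≠ j → ∫ x, g i x * g j x ∂μ ≤ τ)
    {q : X → ℝ} (hq : MemLp q 2 μ) (ht : 0 ≤ t) (S : Finset ι)
    (hS : ∀ i ∈ S, t ≤ ∫ x, q x * g i x ∂μ) :
    (S.card : ℝ) * (t ^ 2 - (∫ x, q x ^ 2 ∂μ) * τ) ≤ (∫ x, q x ^ 2 ∂μ) * β := by
  classical
  set W := ∫ x, q x ^ 2 ∂μ with hW
  have hW0 : 0 ≤ W := integral_nonneg fun x => sq_nonneg _
  rcases S.eq_empty_or_nonempty with rfl | hne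
  · simpa using mul_nonneg hW0 hβ
  -- Cauchy–Schwarz for q against the sum of the `g i` over S: the pairing is at least |S| t, while
  -- the squared norm of the sum is only |S| β + |S|² τ.
  have hG : MemLp (fun x => ∑ i ∈ S, g i x) 2 μ := memLp_finsetSum S fun i _ => hg i
  have hcs := sq_integral_mul_le hq hG
  have h1 : (S.card : ℝ) * t ≤ ∫ x, q x * ∑ i ∈ S, g i x ∂μ := by
    simp_rw [Finset.mul_sum]
    rw [integral_finsetSum _ fun i _ => integrable_mul_of_memLp_two hq (hg i)]
    calc (S.card : ℝ) * t = ∑ i ∈ S, t := by simp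
      _ ≤ _ := Finset.sum_le_sum hS
  have h2 : ∫ x, (∑ i ∈ S, g i x) ^ 2 ∂μ ≤ S.card * β + S.card ^ 2 * τ := by
    simp_rw [sq (∑ i ∈ S, g i _), Finset.sum_mul_sum]
    rw [integral_finsetSum _ fun i _ => integrable_finsetSum _
      fun j _ => integrable_mul_of_memLp_two (hg i) (hg j)]
    have : ∀ i ∈ S, ∫ x, ∑ j ∈ S, g i x * g j x ∂μ ≤ β + S.card * τ := by
      intro i hi
      rw [integral_finsetSum _ fun j _ => integrable_mul_of_memLp_two (hg i) (hg j),
        ← Finset.add_sum_erase S _ hi]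
      refine add_le_add ?_ ?_
      · simpa [sq] using hdiag i
      · calc _ ≤ ∑ j ∈ S.erase i, τ :=
              Finset.sum_le_sum fun j hj => hoff i j (Finset.ne_of_mem_erase hj).symm
          _ = ((S.erase i).card : ℝ) * τ := by simp
          _ ≤ _ := by gcongr; exact Finset.erase_subset _ _
    calc _ ≤ ∑ i ∈ S, (β + S.card * τ) := Finset.sum_le_sum this
      _ = _ := by simp; ring
  have hn : (0 : ℝ) < S.card := by exact_mod_cast hne.card_pos
  have h3 : ((S.card : ℝ) * t) ^ 2 ≤ W * (S.card * β + S.card ^ 2 * τ) :=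
    (pow_le_pow_left₀ (by positivity) h1 2).trans (hcs.trans (by gcongr))
  have : (S.card : ℝ) * (S.card * (t ^ 2 - W * τ)) ≤ S.card * (W * β) := by nlinarith
  exact le_of_mul_le_mul_left this hn

/-- The measure with density `1 + g`. -/
noncomputable def tilt {X : Type*} [MeasurableSpace X] (μ : Measure X) (g : X → ℝ) : Measure X :=
  μ.withDensity fun x => ENNReal.ofReal (1 + g x)

theorem integral_tilt {X : Type*} [MeasurableSpace X] {μ : Measure X} [IsFiniteMeasure μ]
    {g : X → ℝ} (hg : Measurable g) (hb : ∀ x, |g x| ≤ 1 / 2) (q : X → ℝ) :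
    ∫ x, q x ∂(tilt μ g) = ∫ x, (1 + g x) * q x ∂μ := by
  rw [tilt, integral_withDensity_eq_integral_toReal_smul (by fun_prop)
    (Filter.Eventually.of_forall fun x => ENNReal.ofReal_lt_top)]
  refine integral_congr_ae (Filter.Eventually.of_forall fun x => ?_)
  have := abs_le.1 (hb x)
  simp only [smul_eq_mul]
  rw [ENNReal.toReal_ofReal (by linarith)]

theorem isProbabilityMeasure_tilt {X : Type*} [MeasurableSpace X] {μ : Measure X}
    [IsProbabilityMeasure μ] {g : X → ℝ} (hg : Measurable g) (hb : ∀ x, |g x| ≤ 1 / 2)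
    (h0 : ∫ x, g x ∂μ = 0) : IsProbabilityMeasure (tilt μ g) := by
  have hgi : Integrable g μ := Integrable.of_bound hg.aestronglyMeasurable (1 / 2)
    (Filter.Eventually.of_forall hb)
  have hi : Integrable (fun x => 1 + g x) μ := (integrable_const _).add hgi
  constructor
  rw [tilt, withDensity_apply _ MeasurableSet.univ, Measure.restrict_univ,
    ← ofReal_integral_eq_lintegral_ofReal hi
      (Filter.Eventually.of_forall fun x => by
        have := abs_le.1 (hb x); simp only [Pi.zero_apply]; linarith),
    integral_add (integrable_const _) hgi, h0]
  simp

theorem memLp_two_of_bound {X : Type*} [MeasurableSpace X] {μ : Measure X} [IsFiniteMeasure μ]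
    {f : X → ℝ} (hf : Measurable f) {c : ℝ} (hb : ∀ x, |f x| ≤ c) : MemLp f 2 μ :=
  MemLp.of_bound hf.aestronglyMeasurable c (Filter.Eventually.of_forall hb)

theorem integral_sq_le_sq {X : Type*} [MeasurableSpace X] {μ : Measure X} [IsProbabilityMeasure μ]
    {f : X → ℝ} (hf : Measurable f) {c : ℝ} (hb : ∀ x, |f x| ≤ c) : ∫ x, f x ^ 2 ∂μ ≤ c ^ 2 := by
  calc _ ≤ ∫ x, c ^ 2 ∂μ := by
        refine integral_mono (memLp_two_of_bound hf hb).integrable_sq (integrable_const _)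
          fun x => ?_
        have := pow_le_pow_left₀ (abs_nonneg (f x)) (hb x) 2
        rwa [sq_abs] at this
    _ = c ^ 2 := by simp

theorem Query.abs_le_one {X : Type*} [MeasurableSpace X] (q : Query X) (x : X) : |q.fn x| ≤ 1 :=
  abs_le.2 (q.bounded_fn x)

/-- The tilted density is at least 1/2, and the mean minimises the mean square deviation. This turns
the tolerance, which refers to the tilted measure, into one that refers to μ alone. -/
theorem variance_tilt_ge {X : Type*} [MeasurableSpace X] {μ : Measure X}
    [IsProbabilityMeasure μ] {g : X → ℝ} (hg : Measurable g) (hb : ∀ x, |g x| ≤ 1 / 2)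
    (h0 : ∫ x, g x ∂μ = 0) (q : Query X) :
    variance q.fn μ / 2 ≤ variance q.fn (tilt μ g) := by
  have := isProbabilityMeasure_tilt hg hb h0
  have hq := q.measurable_fn
  set c := ∫ x, q.fn x ∂(tilt μ g) with hc
  have hqc : Measurable fun x => q.fn x - c := hq.sub_const c
  have hbd : ∀ x, |q.fn x - c| ≤ 1 + |c| := fun x =>
    (abs_sub _ _).trans (by gcongr; exact q.abs_le_one x)
  have hi : Integrable (fun x => (q.fn x - c) ^ 2) μ := (memLp_two_of_bound hqc hbd).integrable_sq
  have hi2 : Integrable (fun x => (1 + g x) * (q.fn x - c) ^ 2) μ := by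
    refine hi.bdd_mul (c := 3 / 2) (by fun_prop) (Filter.Eventually.of_forall fun x => ?_)
    have := abs_le.1 (hb x)
    rw [Real.norm_eq_abs, abs_le]
    constructor <;> linarith
  rw [variance_eq_integral (μ := tilt μ g) hq.aemeasurable, ← hc, integral_tilt hg hb]
  have h1 : variance q.fn μ ≤ ∫ x, (q.fn x - c) ^ 2 ∂μ := by
    rw [← variance_sub_const hq.aestronglyMeasurable c]
    exact variance_le_expectation_sq hqc.aestronglyMeasurable
  have h2 : (∫ x, (q.fn x - c) ^ 2 ∂μ) / 2 ≤ ∫ x, (1 + g x) * (q.fn x - c) ^ 2 ∂μ := by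
    rw [← integral_div]
    refine integral_mono (hi.div_const 2) hi2 fun x => ?_
    have := abs_le.1 (hb x)
    nlinarith [sq_nonneg (q.fn x - c)]
  linarith

/-- A query to `VSTAT(u)` distinguishes few of the tilted measures from the base measure. -/
theorem card_distinguished_le {X ι : Type*} [MeasurableSpace X] [Fintype ι] {μ : Measure X}
    [IsProbabilityMeasure μ] {g : ι → X → ℝ} {τ : ℝ} (hg : ∀ i, Measurable (g i))
    (hb : ∀ i x, |g i x| ≤ 1 / 2) (h0 : ∀ i, ∫ x, g i x ∂μ = 0) (hτ : 0 ≤ τ)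
    (hoff : ∀ i j, i ≠ j → ∫ x, g i x * g j x ∂μ ≤ τ) (q : Query X) (hu : 4 * q.u * τ ≤ 1)
    (S : Finset ι) (hS : ∀ i ∈ S, q.tolerance (tilt μ (g i))
      < |∫ x, q.fn x ∂μ - ∫ x, q.fn x ∂(tilt μ (g i))|) :
    (S.card : ℝ) ≤ 2 * q.u := by
  classical
  have hq := q.measurable_fn
  have hupos := q.u_pos
  set c := ∫ x, q.fn x ∂μ with hc
  have hqc : Measurable fun x => q.fn x - c := hq.sub_const c
  have hbd : ∀ x, |q.fn x - c| ≤ 1 + |c| := fun x =>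
    (abs_sub _ _).trans (by gcongr; exact q.abs_le_one x)
  have hL : MemLp (fun x => q.fn x - c) 2 μ := memLp_two_of_bound hqc hbd
  have hgL : ∀ i, MemLp (g i) 2 μ := fun i => memLp_two_of_bound (hg i) (hb i)
  have hgi : ∀ i, Integrable (g i) μ := fun i => (hgL i).integrable one_le_two
  have hqL : MemLp q.fn 2 μ := memLp_two_of_bound hq q.abs_le_one
  have hqi : Integrable q.fn μ := hqL.integrable one_le_two
  set W := variance q.fn μ with hWdef
  have hW : W = ∫ x, (q.fn x - c) ^ 2 ∂μ := variance_eq_integral hq.aemeasurable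
  -- Since `g i` has mean zero, the query may be centred, so that its squared norm becomes its
  -- variance W.
  have hdiff : ∀ i, ∫ x, q.fn x ∂(tilt μ (g i)) - c = ∫ x, (q.fn x - c) * g i x ∂μ := by
    intro i
    have hm : Integrable (fun x => q.fn x * g i x) μ := hqL.integrable_mul (hgL i)
    rw [integral_tilt (hg i) (hb i)]
    have e1 : (fun x => (1 + g i x) * q.fn x) = fun x => q.fn x + q.fn x * g i x := by
      funext x; ring
    have e2 : (fun x => (q.fn x - c) * g i x) = fun x => q.fn x * g i x - c * g i x := by
      funext x; ring
    rw [e1, e2, integral_add hqi hm, integral_sub hm ((hgi i).const_mul c),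
      integral_const_mul, h0 i]
    ring
  have hdiag : ∀ i, ∫ x, g i x ^ 2 ∂μ ≤ 1 / 4 := fun i =>
    (integral_sq_le_sq (hg i) (hb i)).trans (by norm_num)
  rcases S.eq_empty_or_nonempty with rfl | ⟨i₀, hi₀⟩
  · simpa using hupos.le
  -- W is cancelled below. A query of zero variance separates nothing, because the tolerance is
  -- positive.
  have hWpos : 0 < W := by
    have h1 := hS i₀ hi₀
    have h2 : 0 < q.tolerance (tilt μ (g i₀)) :=
      lt_of_lt_of_le (by positivity) (le_max_left (1 / q.u) _)
    rw [abs_sub_comm, hdiff] at h1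
    have h3 := sq_integral_mul_le hL (hgL i₀)
    rw [← hW] at h3
    have h4 : 0 < (∫ x, (q.fn x - c) * g i₀ x ∂μ) ^ 2 := by
      rw [← sq_abs]; exact pow_pos (h2.trans h1) 2
    by_contra hcon
    have : W = 0 := le_antisymm (not_lt.1 hcon) (variance_nonneg _ _)
    rw [this] at h3
    linarith
  set t := Real.sqrt (W / (2 * q.u)) with ht
  have ht2 : t ^ 2 = W / (2 * q.u) := Real.sq_sqrt (by positivity)
  have htol : ∀ i ∈ S, t ≤ |∫ x, (q.fn x - c) * g i x ∂μ| := by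
    intro i hi
    have h1 := hS i hi
    rw [abs_sub_comm, hdiff] at h1
    refine le_trans ?_ h1.le
    refine le_trans ?_ (le_max_right _ _)
    refine Real.sqrt_le_sqrt ?_
    have := variance_tilt_ge (hg i) (hb i) (h0 i) q
    rw [← div_div]
    gcongr
  -- Used for the centred query and for its negative; each sign accounts for at most u indices.
  have main : ∀ (f : X → ℝ) (_ : MemLp f 2 μ) (_ : ∫ x, f x ^ 2 ∂μ = W) (T : Finset ι)
      (_ : ∀ i ∈ T, t ≤ ∫ x, f x * g i x ∂μ), (T.card : ℝ) ≤ q.u := by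
    intro f hf hfW T hT
    have h := card_mul_le_of_correlated hgL (by norm_num) hdiag hτ hoff hf (Real.sqrt_nonneg _) T hT
    rw [hfW, ht2] at h
    have h1 : (T.card : ℝ) * (1 / (2 * q.u) - τ) ≤ 1 / 4 := by
      refine le_of_mul_le_mul_left ?_ hWpos
      calc _ = (T.card : ℝ) * (W / (2 * q.u) - W * τ) := by ring
        _ ≤ _ := h
    have h2 : 1 / (4 * q.u) ≤ 1 / (2 * q.u) - τ := by
      have : τ ≤ 1 / (4 * q.u) := by rw [le_div_iff₀ (by positivity)]; linarith
      have e : 1 / (2 * q.u) = 1 / (4 * q.u) + 1 / (4 * q.u) := by field_simp; norm_num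
      linarith
    have h3 : (T.card : ℝ) * (1 / (4 * q.u)) ≤ 1 / 4 := le_trans (by gcongr) h1
    have h4 : (T.card : ℝ) * (1 / (4 * q.u)) = T.card / q.u / 4 := by field_simp
    rw [h4] at h3
    have : (T.card : ℝ) / q.u ≤ 1 := by linarith
    rwa [div_le_one hupos] at this
  have hp := main _ hL hW.symm (S.filter fun i => 0 ≤ ∫ x, (q.fn x - c) * g i x ∂μ) (by
    intro i hi
    rw [Finset.mem_filter] at hi
    simpa [abs_of_nonneg hi.2] using htol i hi.1)
  have hn := main (fun x => -(q.fn x - c)) hL.neg (by simp only [neg_sq]; exact hW.symm)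
    (S.filter fun i => ¬ 0 ≤ ∫ x, (q.fn x - c) * g i x ∂μ) (by
    intro i hi
    rw [Finset.mem_filter] at hi
    have h1 := htol i hi.1
    rw [abs_of_neg (not_le.1 hi.2)] at h1
    simp_rw [neg_mul, integral_neg]
    exact h1)
  have := Finset.card_filter_add_card_filter_not (s := S)
    (fun i => 0 ≤ ∫ x, (q.fn x - c) * g i x ∂μ)
  have h5 : (S.card : ℝ) = ((S.filter fun i => 0 ≤ ∫ x, (q.fn x - c) * g i x ∂μ).card : ℝ)
      + ((S.filter fun i => ¬ 0 ≤ ∫ x, (q.fn x - c) * g i x ∂μ).card : ℝ) := by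
    exact_mod_cast this.symm
  linarith

/-! ### Running an SQ algorithm against many oracles -/

/-- If every affordable query separates few of the oracles `O i` from `O₀`, then the algorithm has
the same output for most of the oracles for which it stays within its budget. -/
theorem exists_common_result {X Y ι : Type*} [MeasurableSpace X] [Fintype ι] [DecidableEq ι]
    (O₀ : Query X → ℝ) (O : ι → Query X → ℝ) (U : ℝ) (M : ℕ)
    (hM : ∀ q : Query X, q.u < U → ∃ S : Finset ι, S.card ≤ M ∧ ∀ i ∉ S, O i q = O₀ q)
    (N : ℕ) : ∀ T : SQAlg X Y, Nonempty Y → ∃ y : Y, ∃ S : Finset ι, S.card ≤ N * M ∧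
      ∀ i ∉ S, (T.queries (O i)).length ≤ N → (∀ q ∈ T.queries (O i), q.u < U) →
        T.result (O i) = y := by
  induction N with
  | zero =>
    intro T hY
    cases T with
    | output y => exact ⟨y, ∅, by simp, fun i _ _ _ => rfl⟩
    -- With no queries allowed the claim is vacuous here, and any output serves.
    | query q next => exact ⟨hY.some, ∅, by simp, fun i _ h _ => by simp [SQAlg.queries] at h⟩
  | succ N ih =>
    intro T hY
    cases T with
    | output y => exact ⟨y, ∅, by simp, fun i _ _ _ => rfl⟩
    | query q next =>
      by_cases hq : q.u < U
      · obtain ⟨S₁, hS₁, h₁⟩ := hM q hq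
        obtain ⟨y, S₂, hS₂, h₂⟩ := ih (next (O₀ q)) hY
        -- Outside S₁ the answer is the reference one, so all these runs descend into the same
        -- subtree.
        refine ⟨y, S₁ ∪ S₂, ?_, fun i hi hlen hu => ?_⟩
        · calc _ ≤ S₁.card + S₂.card := Finset.card_union_le _ _
            _ ≤ M + N * M := by gcongr
            _ = _ := by ring
        · rw [Finset.mem_union, not_or] at hi
          simp only [SQAlg.queries, List.length_cons, List.mem_cons, forall_eq_or_imp,
            h₁ i hi.1] at hlen hu
          simp only [SQAlg.result, h₁ i hi.1]
          exact h₂ i hi.2 (by omega) hu.2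
      · exact ⟨hY.some, ∅, by simp, fun i _ _ hu => absurd (hu q (by simp [SQAlg.queries])) hq⟩

/-- If each of finitely many events has outer probability at most `1/3`, then up to a null set
some outcome lies in at most a third of them. -/
theorem exists_few_failures {Ω ι : Type*} [MeasurableSpace Ω] [Fintype ι] (P : Measure Ω)
    [IsProbabilityMeasure P] (F G : ι → Set Ω) (hF : ∀ i, P (F i) ≤ 1 / 3)
    (hG : ∀ i, P (G i) = 0) :
    ∃ ω, (∀ i, ω ∉ G i) ∧ ∃ S : Finset ι, (S.card : ℝ) ≤ Fintype.card ι / 3 ∧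
      ∀ i ∉ S, ω ∉ F i := by
  classical
  -- The number of failures, with each event replaced by a measurable hull of the same measure. Its
  -- mean is at most a third of the number of events, and some outcome outside the null set does not
  -- exceed the mean.
  set f : Ω → ℝ := fun ω => ∑ i, (toMeasurable P (F i)).indicator 1 ω with hf
  have hint : ∀ i, Integrable ((toMeasurable P (F i)).indicator (1 : Ω → ℝ)) P := fun i =>
    (integrable_const (1 : ℝ)).indicator (measurableSet_toMeasurable _ _)
  have hfi : Integrable f P := integrable_finsetSum _ fun i _ => hint i
  have hval : ∫ ω, f ω ∂P ≤ Fintype.card ι / 3 := by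
    rw [hf, integral_finsetSum _ fun i _ => hint i]
    calc _ ≤ ∑ i : ι, (1 / 3 : ℝ) := by
          refine Finset.sum_le_sum fun i _ => ?_
          rw [integral_indicator_one (measurableSet_toMeasurable _ _), measureReal_def,
            measure_toMeasurable]
          have := ENNReal.toReal_mono (by norm_num) (hF i)
          simpa using this
      _ = _ := by simp; ring
  have hnull : ∀ᵐ ω ∂P, ∀ i, ω ∉ G i := by
    rw [ae_all_iff]; exact fun i => measure_eq_zero_iff_ae_notMem.1 (hG i)
  obtain ⟨ω, hω1, hω2⟩ : ∃ ω, ω ∉ {ω | ¬ ∀ i, ω ∉ G i} ∧ f ω ≤ ∫ ω, f ω ∂P :=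
    exists_notMem_null_le_integral hfi hnull
  refine ⟨ω, by simpa using hω1, Finset.univ.filter fun i => ω ∈ toMeasurable P (F i), ?_, ?_⟩
  · refine le_trans (le_of_eq ?_) (hω2.trans hval)
    simp [hf, Set.indicator_apply]
  · intro i hi hi'
    exact hi (by simpa using subset_toMeasurable P (F i) hi')

/-! ### Many almost orthogonal directions -/

/-- The sign `±1` of a Boolean. -/
noncomputable def boolSign (b : Bool) : ℝ := if b then 1 else -1

theorem boolSign_sq (b : Bool) : boolSign b * boolSign b = 1 := by
  cases b <;> simp [boolSign]

theorem sum_exp_boolSign {d : ℕ} (a : Fin d → Bool) (t : ℝ) :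
    ∑ σ : Fin d → Bool, Real.exp (t * ∑ i, boolSign (a i) * boolSign (σ i))
      = (2 * Real.cosh t) ^ d := by
  have h1 : ∀ b : Bool, ∑ c : Bool, Real.exp (t * (boolSign b * boolSign c))
      = 2 * Real.cosh t := by
    intro b
    rw [Real.cosh_eq]
    cases b <;> simp [boolSign] <;> ring
  have h2 := Finset.prod_univ_sum (fun _ : Fin d => (Finset.univ : Finset Bool))
    (fun i c => Real.exp (t * (boolSign (a i) * boolSign c)))
  simp only [h1, Finset.prod_const, Finset.card_univ, Fintype.card_fin,
    Fintype.piFinset_univ] at h2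
  rw [h2]
  refine Finset.sum_congr rfl fun σ _ => ?_
  rw [Finset.mul_sum, Real.exp_sum]

/-- Chernoff bound: exponential moments with parameters ±r and cosh t ≤ exp(t²/2). -/
theorem card_boolSign_sum_ge {d : ℕ} (a : Fin d → Bool) {r : ℝ} (hr : 0 ≤ r) :
    ((Finset.univ.filter fun σ : Fin d → Bool =>
        r * d ≤ |∑ i, boolSign (a i) * boolSign (σ i)|).card : ℝ)
      ≤ 2 * (2 ^ d * Real.exp (-(d * r ^ 2 / 2))) := by
  set s : (Fin d → Bool) → ℝ := fun σ => ∑ i, boolSign (a i) * boolSign (σ i) with hs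
  have key : ∀ t : ℝ, t ^ 2 = r ^ 2 → ∑ σ : Fin d → Bool, Real.exp (t * s σ - r ^ 2 * d)
      ≤ 2 ^ d * Real.exp (-(d * r ^ 2 / 2)) := by
    intro t ht
    simp_rw [Real.exp_sub, ← Finset.sum_div]
    rw [sum_exp_boolSign, mul_pow, mul_div_assoc]
    refine mul_le_mul_of_nonneg_left ?_ (by positivity)
    rw [div_le_iff₀ (Real.exp_pos _), ← Real.exp_add]
    calc Real.cosh t ^ d ≤ Real.exp (t ^ 2 / 2) ^ d :=
          pow_le_pow_left₀ (Real.cosh_pos t).le (Real.cosh_le_exp_half_sq t) d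
      _ = _ := by rw [← Real.exp_nat_mul, ht]; congr 1; ring
  calc ((Finset.univ.filter fun σ : Fin d → Bool => r * d ≤ |s σ|).card : ℝ)
      = ∑ σ : Fin d → Bool, if r * d ≤ |s σ| then (1 : ℝ) else 0 := by simp
    _ ≤ ∑ σ : Fin d → Bool,
        (Real.exp (r * s σ - r ^ 2 * d) + Real.exp (-r * s σ - r ^ 2 * d)) := by
        refine Finset.sum_le_sum fun σ _ => ?_
        split_ifs with h
        · rcases le_abs.1 h with h | h
          · refine le_add_of_le_of_nonneg (Real.one_le_exp ?_) (Real.exp_pos _).le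
            nlinarith [mul_le_mul_of_nonneg_left h hr]
          · refine le_add_of_nonneg_of_le (Real.exp_pos _).le (Real.one_le_exp ?_)
            nlinarith [mul_le_mul_of_nonneg_left h hr]
        · positivity
    _ ≤ _ := by
        rw [Finset.sum_add_distrib, two_mul]
        exact add_le_add (key r rfl) (key (-r) (by ring))

/-- Gilbert–Varshamov: a set of maximal size is also a covering, since any uncovered sign vector
could be added. The Chernoff bound for one covering piece then bounds the size from below. -/
theorem exists_almost_orthogonal_signs {d : ℕ} {r : ℝ} (hr : 0 < r) (hr1 : r ≤ 1) :
    ∃ V : Finset (Fin d → Bool), Real.exp (d * r ^ 2 / 2) / 2 ≤ V.card ∧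
      ∀ a ∈ V, ∀ b ∈ V, a ≠ b → |∑ i, boolSign (a i) * boolSign (b i)| < r * d := by
  classical
  set good : Finset (Fin d → Bool) → Prop := fun V =>
    ∀ a ∈ V, ∀ b ∈ V, a ≠ b → |∑ i, boolSign (a i) * boolSign (b i)| < r * d with hgood
  obtain ⟨V, hV, hmax⟩ := Finset.exists_max_image (Finset.univ.filter good) Finset.card
    ⟨∅, by simp [hgood]⟩
  have hVg : good V := (Finset.mem_filter.1 hV).2
  refine ⟨V, ?_, hVg⟩
  have hcover : (Finset.univ : Finset (Fin d → Bool)) ⊆ V.biUnion fun a =>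
      Finset.univ.filter fun σ => r * d ≤ |∑ i, boolSign (a i) * boolSign (σ i)| := by
    intro σ _
    by_contra hcon
    simp only [Finset.mem_biUnion, Finset.mem_filter, Finset.mem_univ, true_and, not_exists,
      not_and, not_le] at hcon
    -- A sign vector has inner product d ≥ r d with itself, so it would be covered by itself.
    have hσ : σ ∉ V := by
      intro h
      have := hcon σ h
      simp only [boolSign_sq, Finset.sum_const, Finset.card_univ, Fintype.card_fin, nsmul_eq_mul,
        mul_one, Nat.abs_cast] at this
      nlinarith [mul_le_mul_of_nonneg_right hr1 (Nat.cast_nonneg (α := ℝ) d)]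
    have h2 : good (insert σ V) := by
      intro a ha b hb hab
      rw [Finset.mem_insert] at ha hb
      rcases ha with rfl | ha <;> rcases hb with rfl | hb
      · exact absurd rfl hab
      · simp_rw [mul_comm (boolSign (a _))]; exact hcon b hb
      · exact hcon a ha
      · exact hVg a ha b hb hab
    have := hmax _ (Finset.mem_filter.2 ⟨Finset.mem_univ _, h2⟩)
    rw [Finset.card_insert_of_notMem hσ] at this
    omega
  have h3 : ((2 : ℝ) ^ d) ≤ V.card * (2 * (2 ^ d * Real.exp (-(d * r ^ 2 / 2)))) := by
    calc ((2 : ℝ) ^ d) = ((Finset.univ : Finset (Fin d → Bool)).card : ℝ) := by simp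
      _ ≤ ((V.biUnion fun a => Finset.univ.filter fun σ : Fin d → Bool =>
          r * d ≤ |∑ i, boolSign (a i) * boolSign (σ i)|).card : ℝ) := by
          exact_mod_cast Finset.card_le_card hcover
      _ ≤ ∑ a ∈ V, ((Finset.univ.filter fun σ : Fin d → Bool =>
          r * d ≤ |∑ i, boolSign (a i) * boolSign (σ i)|).card : ℝ) := by
          exact_mod_cast Finset.card_biUnion_le
      _ ≤ ∑ a ∈ V, 2 * (2 ^ d * Real.exp (-(d * r ^ 2 / 2))) :=
          Finset.sum_le_sum fun a _ => card_boolSign_sum_ge a hr.le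
      _ = _ := by simp
  have h4 : (1 : ℝ) ≤ V.card * (2 * Real.exp (-(d * r ^ 2 / 2))) := by
    have h2d : (0 : ℝ) < 2 ^ d := by positivity
    refine le_of_mul_le_mul_left ?_ h2d
    calc _ = (2 : ℝ) ^ d := mul_one _
      _ ≤ _ := h3
      _ = _ := by ring
  rw [Real.exp_neg] at h4
  have he := Real.exp_pos (d * r ^ 2 / 2)
  rw [div_le_iff₀ two_pos]
  calc Real.exp (d * r ^ 2 / 2) ≤ Real.exp (d * r ^ 2 / 2)
        * (V.card * (2 * (Real.exp (d * r ^ 2 / 2))⁻¹)) := le_mul_of_one_le_right he.le h4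
    _ = _ := by field_simp

theorem exists_almost_orthogonal {d : ℕ} (hd : 0 < d) {r : ℝ} (hr : 0 < r) (hr1 : r ≤ 1) :
    ∃ (m : ℕ) (v : Fin m → EuclideanSpace ℝ (Fin d)), Real.exp (d * r ^ 2 / 2) / 2 ≤ m ∧
      (∀ i, ‖v i‖ = 1) ∧ ∀ i j, i ≠ j → |inner ℝ (v i) (v j)| ≤ r := by
  obtain ⟨V, hV, hVr⟩ := exists_almost_orthogonal_signs (d := d) hr hr1
  have hd' : (0 : ℝ) < d := by exact_mod_cast hd
  set w : (Fin d → Bool) → EuclideanSpace ℝ (Fin d) := fun a =>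
    WithLp.toLp 2 fun i => boolSign (a i) / Real.sqrt d with hw
  have hinner : ∀ a b, inner ℝ (w a) (w b) = (∑ i, boolSign (a i) * boolSign (b i)) / d := by
    intro a b
    simp only [hw, PiLp.inner_apply, RCLike.inner_apply, conj_trivial]
    rw [Finset.sum_div]
    refine Finset.sum_congr rfl fun i _ => ?_
    rw [div_mul_div_comm, Real.mul_self_sqrt hd'.le, mul_comm]
  refine ⟨V.card, fun i => w (V.equivFin.symm i), hV, fun i => ?_, fun i j hij => ?_⟩
  · have : ‖w (V.equivFin.symm i)‖ ^ 2 = 1 := by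
      rw [← real_inner_self_eq_norm_sq, hinner]
      simp [boolSign_sq, hd'.ne']
    nlinarith [norm_nonneg (w (V.equivFin.symm i))]
  · rw [hinner, abs_div, Nat.abs_cast, div_le_iff₀ hd']
    refine (hVr _ (V.equivFin.symm i).2 _ (V.equivFin.symm j).2 fun h => hij ?_).le
    exact V.equivFin.symm.injective (Subtype.ext h)

/-! ### Correlation of functions of two almost orthogonal directions -/

theorem hasSum_exp_mul_exp (a b : ℝ) :
    HasSum (fun p : ℕ × ℕ => a ^ p.1 / p.1.factorial * (b ^ p.2 / p.2.factorial))
      (Real.exp a * Real.exp b) := by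
  have h : ∀ x : ℝ, HasSum (fun n : ℕ => x ^ n / n.factorial) (Real.exp x) := fun x => by
    rw [Real.exp_eq_exp_ℝ]; exact NormedSpace.expSeries_div_hasSum_exp x
  have hs : Summable fun p : ℕ × ℕ => a ^ p.1 / p.1.factorial * (b ^ p.2 / p.2.factorial) :=
    summable_mul_of_summable_norm (f := fun n : ℕ => a ^ n / n.factorial)
      (g := fun n : ℕ => b ^ n / n.factorial) (h a).summable.norm (h b).summable.norm
  exact HasSum.mul (f := fun n : ℕ => a ^ n / n.factorial)
    (g := fun n : ℕ => b ^ n / n.factorial) (h a) (h b) hs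

/-- The terms of degree `< n` of the power series of `exp (α x - β x²)`. -/
noncomputable def expQuadTrunc (n : ℕ) (α β x : ℝ) : ℝ :=
  ∑ p ∈ (Finset.range n ×ˢ Finset.range n).filter (fun p => p.1 + 2 * p.2 < n),
    (α * x) ^ p.1 / p.1.factorial * ((-(β * x ^ 2)) ^ p.2 / p.2.factorial)

/-- Replacing x by x/η in a term of degree D ≥ n costs a factor η^D ≤ η^n; what remains is dominated
by the full series of absolute values. -/
theorem abs_exp_sub_expQuadTrunc_le (n : ℕ) (α β x : ℝ) {η : ℝ} (hη : 0 < η) (hη1 : η ≤ 1) :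
    |Real.exp (α * x - β * x ^ 2) - expQuadTrunc n α β x|
      ≤ η ^ n * Real.exp (|α| * |x| / η + |β| * x ^ 2 / η ^ 2) := by
  set S := (Finset.range n ×ˢ Finset.range n).filter (fun p : ℕ × ℕ => p.1 + 2 * p.2 < n) with hS
  set f : ℕ × ℕ → ℝ := fun p =>
    (α * x) ^ p.1 / p.1.factorial * ((-(β * x ^ 2)) ^ p.2 / p.2.factorial) with hf
  have h1 : HasSum f (Real.exp (α * x - β * x ^ 2)) := by
    rw [sub_eq_add_neg, Real.exp_add]
    exact hasSum_exp_mul_exp _ _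
  have h2 : HasSum (fun p => if p ∈ S then f p else 0) (expQuadTrunc n α β x) := by
    have : HasSum (fun p => if p ∈ S then f p else 0) (∑ p ∈ S, if p ∈ S then f p else 0) :=
      hasSum_sum_of_ne_finset_zero fun b hb => if_neg hb
    rwa [Finset.sum_congr rfl (fun p hp => if_pos hp)] at this
  have h3 : HasSum (fun p : ℕ × ℕ => η ^ n * ((|α| * |x| / η) ^ p.1 / p.1.factorial
      * ((|β| * x ^ 2 / η ^ 2) ^ p.2 / p.2.factorial)))
      (η ^ n * Real.exp (|α| * |x| / η + |β| * x ^ 2 / η ^ 2)) := by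
    rw [Real.exp_add]
    exact (hasSum_exp_mul_exp _ _).mul_left _
  refine (h1.sub h2).norm_le_of_bounded h3 fun p => ?_
  by_cases hp : p ∈ S
  · rw [if_pos hp, sub_self, norm_zero]; positivity
  · rw [if_neg hp, sub_zero]
    have hdeg : n ≤ p.1 + 2 * p.2 := by
      by_contra hcon
      apply hp
      rw [hS, Finset.mem_filter, Finset.mem_product, Finset.mem_range, Finset.mem_range]
      omega
    have e : ‖f p‖ = η ^ (p.1 + 2 * p.2) * ((|α| * |x| / η) ^ p.1 / p.1.factorial
      * ((|β| * x ^ 2 / η ^ 2) ^ p.2 / p.2.factorial)) := by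
      simp only [hf, norm_mul, norm_div, norm_pow, norm_neg, Real.norm_eq_abs, Nat.abs_cast,
        sq_abs]
      rw [div_pow, div_pow, pow_add, ← pow_mul]
      field_simp
    rw [e]
    exact mul_le_mul_of_nonneg_right (pow_le_pow_of_le_one hη.le hη1 hdeg) (by positivity)

theorem integrable_gaussianReal_iff {μ : ℝ} {v : NNReal} (hv : v ≠ 0) {f : ℝ → ℝ} :
    Integrable f (gaussianReal μ v) ↔ Integrable (fun x => gaussianPDFReal μ v x * f x) := by
  rw [gaussianReal_of_var_ne_zero _ hv, integrable_withDensity_iff_integrable_smul'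
    (measurable_gaussianPDF μ v) (Filter.Eventually.of_forall fun x => gaussianPDF_lt_top)]
  simp [toReal_gaussianPDF]

/-- The dominating function of the correlation estimate; 1/4 lies below the Gaussian exponent 1/2.
-/
theorem integrable_exp_sq_div_four :
    Integrable (fun x : ℝ => Real.exp (x ^ 2 / 4)) (gaussianReal 0 1) := by
  rw [integrable_gaussianReal_iff one_ne_zero]
  have := (integrable_exp_neg_mul_sq (b := 1 / 4) (by norm_num)).const_mul
    (Real.sqrt (2 * Real.pi * ((1 : NNReal) : ℝ)))⁻¹
  refine this.congr (Filter.Eventually.of_forall fun x => ?_)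
  simp only [gaussianPDFReal]
  rw [mul_assoc _ (Real.exp _) (Real.exp _), ← Real.exp_add]
  congr 2
  simp
  ring

theorem integrable_pow_gaussianReal (n : ℕ) :
    Integrable (fun x : ℝ => x ^ n) (gaussianReal 0 1) := by
  rcases Nat.eq_zero_or_pos n with rfl | hn
  · simp
  have h := (memLp_id_gaussianReal (μ := 0) (v := 1) (n : NNReal)).integrable_norm_pow hn.ne'
  refine h.mono' (by fun_prop) (Filter.Eventually.of_forall fun x => ?_)
  simp

theorem integral_mul_expQuadTrunc {φ : ℝ → ℝ} (hφ : Measurable φ) {B : ℝ} (hB : ∀ x, |φ x| ≤ B)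
    {n : ℕ} (hmom : ∀ t < n, ∫ x, φ x * x ^ t ∂(gaussianReal 0 1) = 0) (α β : ℝ) :
    Integrable (fun x => φ x * expQuadTrunc n α β x) (gaussianReal 0 1) ∧
      ∫ x, φ x * expQuadTrunc n α β x ∂(gaussianReal 0 1) = 0 := by
  have hint : ∀ t : ℕ, Integrable (fun x => φ x * x ^ t) (gaussianReal 0 1) := fun t =>
    (integrable_pow_gaussianReal t).bdd_mul hφ.aestronglyMeasurable
      (Filter.Eventually.of_forall hB)
  have e : (fun x => φ x * expQuadTrunc n α β x) = fun x =>
      ∑ p ∈ (Finset.range n ×ˢ Finset.range n).filter (fun p => p.1 + 2 * p.2 < n),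
        (α ^ p.1 / p.1.factorial * ((-β) ^ p.2 / p.2.factorial)) *
          (φ x * x ^ (p.1 + 2 * p.2)) := by
    funext x
    rw [expQuadTrunc, Finset.mul_sum]
    refine Finset.sum_congr rfl fun p _ => ?_
    rw [mul_pow, pow_add, pow_mul, ← neg_mul, mul_pow]
    ring
  rw [e]
  refine ⟨integrable_finsetSum _ fun p _ => (hint _).const_mul _, ?_⟩
  rw [integral_finsetSum _ fun p _ => (hint _).const_mul _]
  refine Finset.sum_eq_zero fun p hp => ?_
  rw [integral_const_mul, hmom _ (Finset.mem_filter.1 hp).2, mul_zero]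

/-- The truncated series has degree < n and integrates to zero against φ, so only the tail of order
η^n contributes. -/
theorem abs_integral_mul_exp_le {φ : ℝ → ℝ} (hφ : Measurable φ) {B : ℝ} (hB : ∀ x, |φ x| ≤ B)
    {n : ℕ} (hmom : ∀ t < n, ∫ x, φ x * x ^ t ∂(gaussianReal 0 1) = 0) (α : ℝ) {β : ℝ}
    (hβ : 0 ≤ β) {η : ℝ} (hη : 0 < η) (hη1 : η ≤ 1) {g : ℝ → ℝ}
    (hg : ∀ x, Real.exp (|α| * |x| / η + β * x ^ 2 / η ^ 2) ≤ g x)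
    (hgi : Integrable g (gaussianReal 0 1)) :
    |∫ x, φ x * Real.exp (α * x - β * x ^ 2) ∂(gaussianReal 0 1)|
      ≤ B * η ^ n * ∫ x, g x ∂(gaussianReal 0 1) := by
  obtain ⟨hi, h0⟩ := integral_mul_expQuadTrunc hφ hB hmom α β
  have hB0 : 0 ≤ B := (abs_nonneg _).trans (hB 0)
  have hbd : ∀ x, ‖φ x * (Real.exp (α * x - β * x ^ 2) - expQuadTrunc n α β x)‖
      ≤ B * η ^ n * g x := by
    intro x
    rw [norm_mul, mul_assoc]
    refine mul_le_mul (hB x) ?_ (norm_nonneg _) hB0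
    refine (abs_exp_sub_expQuadTrunc_le n α β x hη hη1).trans ?_
    rw [abs_of_nonneg hβ]
    gcongr
    exact hg x
  have hm : Measurable fun x => expQuadTrunc n α β x := by
    unfold expQuadTrunc
    fun_prop
  have hd : Integrable (fun x => φ x * (Real.exp (α * x - β * x ^ 2) - expQuadTrunc n α β x))
      (gaussianReal 0 1) :=
    (hgi.const_mul (B * η ^ n)).mono' (by fun_prop) (Filter.Eventually.of_forall hbd)
  have e : (fun x => φ x * Real.exp (α * x - β * x ^ 2)) = fun x =>
      φ x * (Real.exp (α * x - β * x ^ 2) - expQuadTrunc n α β x)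
        + φ x * expQuadTrunc n α β x := by
    funext x; ring
  rw [e, integral_add hd hi, h0, add_zero, ← integral_const_mul]
  exact norm_integral_le_of_norm_le (hgi.const_mul _) (Filter.Eventually.of_forall hbd)

/-- The density of N(ρx, 1 − ρ²) relative to N(0,1) is a constant times the exponential of a
quadratic in y. Its linear and quadratic coefficients are of orders ρ and ρ², so expanding it gives
powers of ρ that match the degree in y. -/
theorem integral_shifted_gaussian (ψ : ℝ → ℝ) (hψ : Measurable ψ) {ρ : ℝ} (hρ : |ρ| < 1) (x : ℝ) :
    ∫ z, ψ (ρ * x + Real.sqrt (1 - ρ ^ 2) * z) ∂(gaussianReal 0 1)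
      = (Real.sqrt (1 - ρ ^ 2))⁻¹ * Real.exp (-(ρ ^ 2 / (2 * (1 - ρ ^ 2)) * x ^ 2)) *
        ∫ y, ψ y * Real.exp (ρ / (1 - ρ ^ 2) * x * y - ρ ^ 2 / (2 * (1 - ρ ^ 2)) * y ^ 2)
          ∂(gaussianReal 0 1) := by
  have hs : 0 < 1 - ρ ^ 2 := by
    have := (sq_lt_one_iff_abs_lt_one ρ).2 hρ
    linarith
  set s := Real.sqrt (1 - ρ ^ 2) with hsdef
  have hs0 : 0 < s := Real.sqrt_pos.2 hs
  have hs2 : s ^ 2 = 1 - ρ ^ 2 := Real.sq_sqrt hs.le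
  have hv : (NNReal.mk (s ^ 2) (sq_nonneg s) * 1 : NNReal) ≠ 0 := by
    rw [mul_one]
    intro h
    have := congrArg NNReal.toReal h
    simp at this
    exact hs0.ne' this
  have hmap : (gaussianReal 0 1).map (fun z => ρ * x + s * z)
      = gaussianReal (ρ * x) (NNReal.mk (s ^ 2) (sq_nonneg s) * 1) := by
    have : (fun z => ρ * x + s * z) = (fun y => ρ * x + y) ∘ fun z => s * z := rfl
    rw [this, ← Measure.map_map (by fun_prop) (by fun_prop), gaussianReal_map_const_mul,
      gaussianReal_map_const_add]
    congr 1
    ring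
  have h1 : ∫ z, ψ (ρ * x + s * z) ∂(gaussianReal 0 1)
      = ∫ y, ψ y ∂((gaussianReal 0 1).map (fun z => ρ * x + s * z)) := by
    rw [integral_map (by fun_prop) hψ.aestronglyMeasurable]
  rw [h1, hmap, integral_gaussianReal_eq_integral_smul hv,
    integral_gaussianReal_eq_integral_smul one_ne_zero, ← integral_const_mul]
  refine integral_congr_ae (Filter.Eventually.of_forall fun y => ?_)
  simp only [gaussianPDFReal, smul_eq_mul, NNReal.coe_mk, NNReal.coe_one,
    mul_one, sub_zero]
  rw [Real.sqrt_mul (by positivity), Real.sqrt_sq hs0.le, hs2, mul_inv]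
  have e : Real.exp (-(y - ρ * x) ^ 2 / (2 * (1 - ρ ^ 2)))
      = Real.exp (-(ρ ^ 2 / (2 * (1 - ρ ^ 2)) * x ^ 2)) * (Real.exp (-y ^ 2 / 2)
        * Real.exp (ρ / (1 - ρ ^ 2) * x * y - ρ ^ 2 / (2 * (1 - ρ ^ 2)) * y ^ 2)) := by
    rw [← Real.exp_add, ← Real.exp_add]
    congr 1
    field_simp
    ring
  rw [e]
  ring

theorem map_inner_stdGaussian {d : ℕ} {v : EuclideanSpace ℝ (Fin d)} (hv : ‖v‖ = 1) :
    (stdGaussian (EuclideanSpace ℝ (Fin d))).map (fun x => inner ℝ v x) = gaussianReal 0 1 := by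
  have h := (IsGaussian.hasGaussianLaw_id (μ := stdGaussian (EuclideanSpace ℝ (Fin d)))).map_fun
    (innerSL ℝ v)
  have h2 := h.map_eq_gaussianReal
  simp only [id, innerSL_apply_apply] at h2
  have h3 := integral_strongDual_stdGaussian (E := EuclideanSpace ℝ (Fin d)) (innerSL ℝ v)
  have h4 := variance_dual_stdGaussian (E := EuclideanSpace ℝ (Fin d)) (innerSL ℝ v)
  rw [innerSL_apply_norm, hv] at h4
  have e : (fun x => inner ℝ v x) = (innerSL ℝ v : EuclideanSpace ℝ (Fin d) → ℝ) := by
    funext x; simp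
  rw [h2, e, h3, h4]
  simp

/-- Jointly Gaussian and uncorrelated, hence independent. -/
theorem map_inner_inner_stdGaussian {d : ℕ} {v e : EuclideanSpace ℝ (Fin d)} (hv : ‖v‖ = 1)
    (he : ‖e‖ = 1) (hve : inner ℝ v e = 0) :
    (stdGaussian (EuclideanSpace ℝ (Fin d))).map (fun x => (inner ℝ v x, inner ℝ e x))
      = (gaussianReal 0 1).prod (gaussianReal 0 1) := by
  have h := (IsGaussian.hasGaussianLaw_id (μ := stdGaussian (EuclideanSpace ℝ (Fin d)))).map_fun
    ((innerSL ℝ v).prod (innerSL ℝ e))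
  simp only [id, ContinuousLinearMap.prod_apply, innerSL_apply_apply] at h
  have hcov : cov[fun x => inner ℝ v x, fun x => inner ℝ e x;
      stdGaussian (EuclideanSpace ℝ (Fin d))] = 0 := by
    rw [← covarianceBilin_apply_eq_cov IsGaussian.memLp_two_id, covarianceBilin_stdGaussian,
      innerSL_apply_apply, hve]
  have hind := h.indepFun_of_covariance_eq_zero hcov
  rw [indepFun_iff_map_prod_eq_prod_map_map (by fun_prop) (by fun_prop),
    map_inner_stdGaussian hv, map_inner_stdGaussian he] at hind
  exact hind

theorem integral_mul_inner_inner {d : ℕ} {v w : EuclideanSpace ℝ (Fin d)} (hv : ‖v‖ = 1)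
    (hw : ‖w‖ = 1) (hρ : |inner ℝ v w| < 1) {φ : ℝ → ℝ} (hφ : Measurable φ) {B : ℝ}
    (hB : ∀ x, |φ x| ≤ B) :
    ∫ x, φ (inner ℝ v x) * φ (inner ℝ w x) ∂(stdGaussian (EuclideanSpace ℝ (Fin d)))
      = ∫ x, φ x * ∫ z, φ (inner ℝ v w * x + Real.sqrt (1 - (inner ℝ v w) ^ 2) * z)
          ∂(gaussianReal 0 1) ∂(gaussianReal 0 1) := by
  set ρ : ℝ := inner ℝ v w with hρdef
  have hs : 0 < 1 - ρ ^ 2 := by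
    have := (sq_lt_one_iff_abs_lt_one ρ).2 hρ
    linarith
  set s := Real.sqrt (1 - ρ ^ 2) with hsdef
  have hs0 : 0 < s := Real.sqrt_pos.2 hs
  have hs2 : s ^ 2 = 1 - ρ ^ 2 := Real.sq_sqrt hs.le
  -- Gram–Schmidt: w = ρ v + s e with e a unit vector orthogonal to v.
  set e : EuclideanSpace ℝ (Fin d) := s⁻¹ • (w - ρ • v) with hedef
  have hvv : inner ℝ v v = (1 : ℝ) := by rw [real_inner_self_eq_norm_sq, hv]; norm_num
  have hww : inner ℝ w w = (1 : ℝ) := by rw [real_inner_self_eq_norm_sq, hw]; norm_num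
  have hve : inner ℝ v e = (0 : ℝ) := by
    rw [hedef, inner_smul_right, inner_sub_right, inner_smul_right, hvv, ← hρdef]
    ring
  have he : ‖e‖ = 1 := by
    have : ‖e‖ ^ 2 = 1 := by
      rw [← real_inner_self_eq_norm_sq, hedef, inner_smul_right, inner_smul_left,
        inner_sub_right, inner_sub_left, inner_sub_left, inner_smul_right, inner_smul_left,
        inner_smul_left, inner_smul_right, hvv, hww, real_inner_comm v w, ← hρdef]
      simp only [conj_trivial]
      have : s⁻¹ * (s⁻¹ * (1 - ρ * ρ - (ρ * ρ - ρ * (ρ * 1)))) = (1 - ρ ^ 2) / s ^ 2 := by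
        field_simp
        ring
      rw [hs2, div_self hs.ne'] at this
      linarith
    nlinarith [norm_nonneg e]
  have hwe : ∀ x, inner ℝ w x = ρ * inner ℝ v x + s * inner ℝ e x := by
    intro x
    rw [hedef, inner_smul_left, inner_sub_left, inner_smul_left]
    simp only [conj_trivial]
    field_simp
    ring
  have hF : Measurable fun p : ℝ × ℝ => φ p.1 * φ (ρ * p.1 + s * p.2) := by fun_prop
  have hB0 : 0 ≤ B := (abs_nonneg _).trans (hB 0)
  calc _ = ∫ x, (fun p : ℝ × ℝ => φ p.1 * φ (ρ * p.1 + s * p.2)) (inner ℝ v x, inner ℝ e x)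
        ∂(stdGaussian (EuclideanSpace ℝ (Fin d))) := by simp_rw [hwe]
    _ = ∫ p, φ p.1 * φ (ρ * p.1 + s * p.2) ∂((gaussianReal 0 1).prod (gaussianReal 0 1)) := by
        rw [← map_inner_inner_stdGaussian hv he hve,
          integral_map (by fun_prop) hF.aestronglyMeasurable]
    _ = _ := by
        rw [integral_prod]
        · simp_rw [integral_const_mul]
        · refine Integrable.of_bound hF.aestronglyMeasurable (B * B)
            (Filter.Eventually.of_forall fun p => ?_)
          rw [norm_mul]
          exact mul_le_mul (hB _) (hB _) (norm_nonneg _) hB0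

/-- Functions of two almost orthogonal directions whose low-degree Gaussian moments vanish are
almost uncorrelated. -/
theorem abs_integral_mul_inner_inner_le {d : ℕ} {v w : EuclideanSpace ℝ (Fin d)} (hv : ‖v‖ = 1)
    (hw : ‖w‖ = 1) {r : ℝ} (hr : 0 < r) (hr8 : r ≤ 1 / 8) (hρ : |inner ℝ v w| ≤ r) {φ : ℝ → ℝ}
    (hφ : Measurable φ) {B : ℝ} (hB : ∀ x, |φ x| ≤ B)
    {n : ℕ} (hmom : ∀ t < n, ∫ x, φ x * x ^ t ∂(gaussianReal 0 1) = 0) :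
    |∫ x, φ (inner ℝ v x) * φ (inner ℝ w x) ∂(stdGaussian (EuclideanSpace ℝ (Fin d)))|
      ≤ 2 * B ^ 2 * (∫ x, Real.exp (x ^ 2 / 4) ∂(gaussianReal 0 1)) ^ 2 * (4 * r) ^ n := by
  have hlt : |inner ℝ v w| < 1 := by linarith
  rw [integral_mul_inner_inner hv hw hlt hφ hB]
  simp_rw [integral_shifted_gaussian φ hφ hlt]
  set ρ : ℝ := inner ℝ v w with hρdef
  set G := ∫ x, Real.exp (x ^ 2 / 4) ∂(gaussianReal 0 1) with hG
  have hG0 : 0 ≤ G := integral_nonneg fun x => (Real.exp_pos _).le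
  have hB0 : 0 ≤ B := (abs_nonneg _).trans (hB 0)
  have hρ2 : ρ ^ 2 ≤ r ^ 2 := by
    rw [← sq_abs]; exact pow_le_pow_left₀ (abs_nonneg _) hρ 2
  have hr2 : r ^ 2 ≤ 1 / 64 := by nlinarith
  have hs : 63 / 64 ≤ 1 - ρ ^ 2 := by linarith
  have hs0 : 0 < 1 - ρ ^ 2 := by linarith
  have hsq : (Real.sqrt (1 - ρ ^ 2))⁻¹ ≤ 2 := by
    rw [inv_le_comm₀ (Real.sqrt_pos.2 hs0) two_pos]
    exact Real.le_sqrt_of_sq_le (by norm_num; linarith)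
  have hb0 : 0 ≤ ρ ^ 2 / (2 * (1 - ρ ^ 2)) := by positivity
  have ha : |ρ / (1 - ρ ^ 2)| ≤ 64 / 63 * r := by
    rw [abs_div, abs_of_pos hs0, div_le_iff₀ hs0]
    nlinarith
  have hb : ρ ^ 2 / (2 * (1 - ρ ^ 2)) ≤ 32 / 63 * r ^ 2 := by
    rw [div_le_iff₀ (by positivity)]
    nlinarith [sq_nonneg r]
  have hinner : ∀ x, |∫ y, φ y * Real.exp (ρ / (1 - ρ ^ 2) * x * y
      - ρ ^ 2 / (2 * (1 - ρ ^ 2)) * y ^ 2) ∂(gaussianReal 0 1)|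
      ≤ B * (4 * r) ^ n * (Real.exp (x ^ 2 / 4) * G) := by
    intro x
    rw [hG, ← integral_const_mul]
    -- The choice η = 4r makes the rescaled exponent at most (16/63)|x||y| + (2/63) y², hence at
    -- most (x² + y²)/4.
    refine abs_integral_mul_exp_le hφ hB hmom _ hb0 (by positivity) (by linarith) (fun y => ?_)
      (integrable_exp_sq_div_four.const_mul _)
    rw [← Real.exp_add]
    refine Real.exp_le_exp.2 ?_
    have h1 : |ρ / (1 - ρ ^ 2) * x| * |y| / (4 * r) ≤ 16 / 63 * (|x| * |y|) := by
      rw [abs_mul, div_le_iff₀ (by positivity)]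
      have := mul_le_mul_of_nonneg_right ha (mul_nonneg (abs_nonneg x) (abs_nonneg y))
      linarith
    have h2 : ρ ^ 2 / (2 * (1 - ρ ^ 2)) * y ^ 2 / (4 * r) ^ 2 ≤ 2 / 63 * y ^ 2 := by
      rw [div_le_iff₀ (by positivity)]
      have := mul_le_mul_of_nonneg_right hb (sq_nonneg y)
      linarith
    have h3 : 2 * (|x| * |y|) ≤ x ^ 2 + y ^ 2 := by
      have := two_mul_le_add_sq |x| |y|
      rw [sq_abs, sq_abs] at this
      linarith
    nlinarith [sq_nonneg x, sq_nonneg y]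
  have hbound : ∀ x, ‖φ x * ((Real.sqrt (1 - ρ ^ 2))⁻¹
      * Real.exp (-(ρ ^ 2 / (2 * (1 - ρ ^ 2)) * x ^ 2)) *
        ∫ y, φ y * Real.exp (ρ / (1 - ρ ^ 2) * x * y - ρ ^ 2 / (2 * (1 - ρ ^ 2)) * y ^ 2)
          ∂(gaussianReal 0 1))‖ ≤ 2 * B ^ 2 * G * (4 * r) ^ n * Real.exp (x ^ 2 / 4) := by
    intro x
    rw [norm_mul, norm_mul, norm_mul, Real.norm_eq_abs, Real.norm_eq_abs, Real.norm_eq_abs,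
      Real.norm_eq_abs, Real.abs_exp, abs_of_pos (inv_pos.2 (Real.sqrt_pos.2 hs0))]
    have h1 : Real.exp (-(ρ ^ 2 / (2 * (1 - ρ ^ 2)) * x ^ 2)) ≤ 1 := by
      rw [Real.exp_le_one_iff]
      have := mul_nonneg hb0 (sq_nonneg x)
      linarith
    calc _ ≤ B * (2 * 1 * (B * (4 * r) ^ n * (Real.exp (x ^ 2 / 4) * G))) := by
          gcongr
          · exact hB x
          · exact hinner x
      _ = _ := by ring
  refine (norm_integral_le_of_norm_le (integrable_exp_sq_div_four.const_mul _)
    (Filter.Eventually.of_forall hbound)).trans ?_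
  rw [integral_const_mul, ← hG]
  exact le_of_eq (by ring)

/-! ### Polynomials with Gaussian weight -/

open Polynomial in
theorem integrable_eval_mul_exp (p : ℝ[X]) {b : ℝ} (hb : 0 < b) :
    Integrable fun x : ℝ => p.eval x * Real.exp (-b * x ^ 2) := by
  simp_rw [eval_eq_sum_range, Finset.sum_mul, mul_assoc]
  refine integrable_finsetSum _ fun i _ => Integrable.const_mul ?_ _
  have h := integrable_rpow_mul_exp_neg_mul_sq hb (s := (i : ℝ))
    (by have := Nat.cast_nonneg (α := ℝ) i; linarith)
  simpa [Real.rpow_natCast] using h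

/-- The integral of a polynomial against the weight `exp (-x ^ 2)`. -/
noncomputable def gaussInt (p : Polynomial ℝ) : ℝ := ∫ x : ℝ, p.eval x * Real.exp (-1 * x ^ 2)

open Polynomial in
theorem gaussInt_add (p q : ℝ[X]) : gaussInt (p + q) = gaussInt p + gaussInt q := by
  rw [gaussInt, gaussInt, gaussInt, ← integral_add (integrable_eval_mul_exp p one_pos)
    (integrable_eval_mul_exp q one_pos)]
  simp [add_mul]

open Polynomial in
theorem gaussInt_C_mul (c : ℝ) (p : ℝ[X]) : gaussInt (C c * p) = c * gaussInt p := by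
  rw [gaussInt, gaussInt, ← integral_const_mul]
  simp [mul_assoc]

open Polynomial in
theorem gaussInt_sub (p q : ℝ[X]) : gaussInt (p - q) = gaussInt p - gaussInt q := by
  have := gaussInt_add (p - q) q
  rw [sub_add_cancel] at this
  linarith

open Polynomial in
theorem gaussInt_mul_self_nonneg (p : ℝ[X]) : 0 ≤ gaussInt (p * p) :=
  integral_nonneg fun x => by
    simp only [eval_mul, Pi.zero_apply]
    exact mul_nonneg (mul_self_nonneg _) (Real.exp_pos _).le

open Polynomial in
-- The derivative of p·exp(-x²) has integral zero.
theorem gaussInt_derivative (p : ℝ[X]) : gaussInt (derivative p) = 2 * gaussInt (X * p) := by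
  have hd : ∀ x : ℝ, HasDerivAt (fun x => p.eval x * Real.exp (-1 * x ^ 2))
      ((derivative p - C 2 * (X * p)).eval x * Real.exp (-1 * x ^ 2)) x := by
    intro x
    have h1 : HasDerivAt (fun x : ℝ => -1 * x ^ 2) (-1 * (2 * x)) x := by
      simpa using (hasDerivAt_pow 2 x).const_mul (-1 : ℝ)
    refine ((p.hasDerivAt x).mul h1.exp).congr_deriv ?_
    simp
    ring
  have h := integral_eq_zero_of_hasDerivAt_of_integrable hd
    (integrable_eval_mul_exp _ one_pos) (integrable_eval_mul_exp p one_pos)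
  have h2 : gaussInt (derivative p - C 2 * (X * p)) = 0 := h
  rw [gaussInt_sub, gaussInt_C_mul] at h2
  linarith

open Polynomial in
/-- The adjoint of the derivative for the weight `exp (-x ^ 2)`. -/
noncomputable def derivAdj (p : ℝ[X]) : ℝ[X] := C 2 * (X * p) - derivative p

open Polynomial in
theorem gaussInt_derivative_mul (p r : ℝ[X]) :
    gaussInt (derivative p * r) = gaussInt (p * derivAdj r) := by
  have h := gaussInt_derivative (p * r)
  rw [derivative_mul, gaussInt_add] at h
  have e : p * derivAdj r = C 2 * (X * (p * r)) - p * derivative r := by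
    rw [derivAdj]; ring
  rw [e, gaussInt_sub, gaussInt_C_mul]
  linarith

open Polynomial in
-- The commutator of the derivative with its adjoint is multiplication by 2.
theorem gaussInt_derivAdj_sq (r : ℝ[X]) : gaussInt (derivAdj r * derivAdj r)
    = gaussInt (derivative r * derivative r) + 2 * gaussInt (r * r) := by
  rw [← gaussInt_derivative_mul (derivAdj r) r]
  have e : derivative (derivAdj r) * r = C 2 * (r * r) + r * derivAdj (derivative r) := by
    simp only [derivAdj, derivative_sub, derivative_mul, derivative_C, derivative_X]
    ring
  rw [e, gaussInt_add, gaussInt_C_mul, ← gaussInt_derivative_mul]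
  ring

open Polynomial in
theorem gaussInt_mul_sq_le (p r : ℝ[X]) :
    gaussInt (p * r) ^ 2 ≤ gaussInt (p * p) * gaussInt (r * r) := by
  have key : ∀ t : ℝ, 0 ≤ gaussInt (r * r) * (t * t) + (2 * gaussInt (p * r)) * t
      + gaussInt (p * p) := by
    intro t
    have h := gaussInt_mul_self_nonneg (p + C t * r)
    have e : (p + C t * r) * (p + C t * r)
        = p * p + C (2 * t) * (p * r) + C (t * t) * (r * r) := by
      simp only [C_mul, map_ofNat]
      ring
    rw [e, gaussInt_add, gaussInt_add, gaussInt_C_mul, gaussInt_C_mul] at h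
    linarith
  have := discrim_le_zero key
  rw [discrim] at this
  nlinarith

open Polynomial in
-- Induction on the degree. Cauchy–Schwarz for ‖p'‖² = ⟨p, D*p'⟩ gives ‖p'‖⁴ ≤ ‖p‖² (‖p''‖² +
-- 2‖p'‖²), and the induction hypothesis bounds ‖p''‖² by 2k‖p'‖².
theorem gaussInt_derivative_sq_le (k : ℕ) : ∀ p : ℝ[X], p.natDegree ≤ k →
    gaussInt (derivative p * derivative p) ≤ 2 * k * gaussInt (p * p) := by
  induction k with
  | zero =>
    intro p hp
    rw [natDegree_eq_zero.1 (Nat.le_zero.1 hp) |>.choose_spec.symm]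
    simp [gaussInt]
  | succ k ih =>
    intro p hp
    have hr := ih (derivative p) ((natDegree_derivative_le p).trans (by omega))
    have h0 := gaussInt_mul_self_nonneg p
    have h1 := gaussInt_mul_self_nonneg (derivative p)
    have h2 := gaussInt_mul_sq_le p (derivAdj (derivative p))
    rw [← gaussInt_derivative_mul, gaussInt_derivAdj_sq] at h2
    push_cast
    set a := gaussInt (derivative p * derivative p)
    set b := gaussInt (p * p)
    rcases h1.eq_or_lt with h | h
    · rw [← h]; positivity
    · have h3 : a * a ≤ a * (2 * (k + 1) * b) := by nlinarith
      exact le_of_mul_le_mul_left h3 h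

open Polynomial in
theorem gaussInt_add_sq_le (p r : ℝ[X]) : gaussInt ((p + r) * (p + r))
    ≤ 2 * gaussInt (p * p) + 2 * gaussInt (r * r) := by
  have h := gaussInt_mul_self_nonneg (p - r)
  have e : (p - r) * (p - r) + (p + r) * (p + r) = C 2 * (p * p) + C 2 * (r * r) := by
    simp only [map_ofNat]
    ring
  have e2 := congrArg gaussInt e
  rw [gaussInt_add, gaussInt_add, gaussInt_C_mul, gaussInt_C_mul] at e2
  linarith

open Polynomial in
theorem gaussInt_derivAdj_sq_le {k : ℕ} {p : ℝ[X]} (hp : p.natDegree ≤ k) :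
    gaussInt (derivAdj p * derivAdj p) ≤ (2 * k + 2) * gaussInt (p * p) := by
  rw [gaussInt_derivAdj_sq]
  have := gaussInt_derivative_sq_le k p hp
  linarith

open Polynomial in
-- Multiplication by X is half the sum of the derivative and its adjoint.
theorem gaussInt_X_mul_sq_le {k : ℕ} {p : ℝ[X]} (hp : p.natDegree ≤ k) :
    gaussInt ((X * p) * (X * p)) ≤ (2 * k + 1) * gaussInt (p * p) := by
  have h1 := gaussInt_derivative_sq_le k p hp
  have h2 := gaussInt_derivAdj_sq_le hp
  have h3 := gaussInt_add_sq_le (derivative p) (derivAdj p)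
  have e : (derivative p + derivAdj p) * (derivative p + derivAdj p)
      = C 4 * ((X * p) * (X * p)) := by
    simp only [derivAdj, map_ofNat]
    ring
  rw [e, gaussInt_C_mul] at h3
  linarith

open Polynomial in
-- Here p' − Xp is half the difference of p' and D*p. Since it is the polynomial factor of
-- (p·exp(-x²/2))', this is the Bernstein inequality for such functions.
theorem gaussInt_derivative_sub_X_mul_sq_le {k : ℕ} {p : ℝ[X]} (hp : p.natDegree ≤ k) :
    gaussInt ((derivative p - X * p) * (derivative p - X * p)) ≤ (2 * k + 1) * gaussInt (p * p) := by
  have h1 := gaussInt_derivative_sq_le k p hp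
  have h2 := gaussInt_derivAdj_sq_le hp
  have h3 := gaussInt_add_sq_le (derivative p) (-derivAdj p)
  have e : (derivative p + -derivAdj p) * (derivative p + -derivAdj p)
      = C 4 * ((derivative p - X * p) * (derivative p - X * p)) := by
    simp only [derivAdj, map_ofNat]
    ring
  rw [e, gaussInt_C_mul, neg_mul_neg] at h3
  linarith

open Polynomial in
theorem gaussInt_X_pow_mul_sq_le {k : ℕ} {p : ℝ[X]} (hp : p.natDegree ≤ k) (m : ℕ) :
    gaussInt ((X ^ m * p) * (X ^ m * p)) ≤ (2 * (k + m)) ^ m * gaussInt (p * p) := by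
  have h : ∀ j ≤ m, gaussInt ((X ^ j * p) * (X ^ j * p))
      ≤ (2 * (k + m)) ^ j * gaussInt (p * p) := by
    intro j
    induction j with
    | zero => intro _; simp
    | succ j ih =>
      intro hj
      have hdeg : (X ^ j * p).natDegree ≤ k + j := by
        refine natDegree_mul_le.trans ?_
        rw [natDegree_X_pow]
        omega
      have h1 := gaussInt_X_mul_sq_le hdeg
      have h2 := ih (by omega)
      have e : X ^ (j + 1) * p = X * (X ^ j * p) := by ring
      rw [e]
      have hjm : (j : ℝ) + 1 ≤ m := by exact_mod_cast hj
      have hk : (0 : ℝ) ≤ k := Nat.cast_nonneg k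
      have hj0 : (0 : ℝ) ≤ j := Nat.cast_nonneg j
      calc _ ≤ (2 * ((k + j : ℕ) : ℝ) + 1) * gaussInt ((X ^ j * p) * (X ^ j * p)) := h1
        _ ≤ (2 * (k + m)) * ((2 * (k + m)) ^ j * gaussInt (p * p)) := by
            refine mul_le_mul ?_ h2 (gaussInt_mul_self_nonneg _) (by positivity)
            push_cast
            linarith
        _ = _ := by ring
  exact h m le_rfl

/-! ### Sampling inequalities -/

theorem sq_intervalIntegral_le {f : ℝ → ℝ} (hf : Continuous f) {a b : ℝ} (hab : a ≤ b) :
    (∫ z in a..b, f z) ^ 2 ≤ (b - a) * ∫ z in a..b, f z ^ 2 := by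
  have hm : ∀ f : ℝ → ℝ, Continuous f → MemLp f 2 (volume.restrict (Set.Ioc a b)) := fun f hf =>
    (memLp_two_iff_integrable_sq hf.aestronglyMeasurable).2 (hf.pow 2).integrableOn_Ioc
  have h := sq_integral_mul_le (hm _ continuous_const) (hm f hf) (f := fun _ => 1)
  rw [intervalIntegral.integral_of_le hab, intervalIntegral.integral_of_le hab]
  simpa [hab] using h

theorem sq_sub_le_of_hasDerivAt {q q' : ℝ → ℝ} (hq : ∀ x, HasDerivAt q (q' x) x)
    (hq' : Continuous q') {a b : ℝ} (hab : a ≤ b) {x y : ℝ} (hx : x ∈ Set.Icc a b)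
    (hy : y ∈ Set.Icc a b) : (q x - q y) ^ 2 ≤ (b - a) * ∫ z in a..b, q' z ^ 2 := by
  have h1 : ∫ z in y..x, q' z = q x - q y :=
    intervalIntegral.integral_eq_sub_of_hasDerivAt (fun z _ => hq z)
      (hq'.intervalIntegrable _ _)
  have h2 : |∫ z in y..x, q' z| ≤ (∫ z in a..b, |q' z|) := by
    calc |∫ z in y..x, q' z| ≤ |(∫ z in y..x, |q' z|)| :=
          by simpa only [Real.norm_eq_abs] using
            intervalIntegral.norm_integral_le_abs_integral_norm (f := q') (a := y) (b := x)
              (μ := volume)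
      _ ≤ |(∫ z in a..b, |q' z|)| := by
          refine intervalIntegral.abs_integral_mono_interval ?_
            (Filter.Eventually.of_forall fun z => abs_nonneg _)
            (hq'.abs.intervalIntegrable _ _)
          rw [Set.uIoc_of_le hab, Set.uIoc]
          exact Set.Ioc_subset_Ioc (le_min hy.1 hx.1) (max_le hy.2 hx.2)
      _ = _ := abs_of_nonneg (intervalIntegral.integral_nonneg hab fun z _ => abs_nonneg _)
  have h3 := sq_intervalIntegral_le hq'.abs hab
  simp_rw [sq_abs] at h3
  rw [h1] at h2
  rw [← sq_abs]
  exact (pow_le_pow_left₀ (abs_nonneg _) h2 2).trans h3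

/-- Poincaré inequality on one cell, with a crude constant: q differs from its mean by at most its
oscillation, which Cauchy–Schwarz bounds through q'. -/
theorem intervalIntegral_sq_le {q q' : ℝ → ℝ} (hq : ∀ x, HasDerivAt q (q' x) x)
    (hq' : Continuous q') (a : ℝ) {h : ℝ} (hh : 0 < h) :
    ∫ z in a..(a + h), q z ^ 2 ≤ (∫ z in a..(a + h), q z) ^ 2 / h
      + h ^ 2 * ∫ z in a..(a + h), q' z ^ 2 := by
  have hqc : Continuous q := continuous_iff_continuousAt.2 fun x => (hq x).continuousAt
  have hab : a ≤ a + h := by linarith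
  set D := ∫ z in a..(a + h), q' z ^ 2 with hD
  set I := ∫ z in a..(a + h), q z with hI
  have hpt : ∀ x ∈ Set.Icc a (a + h), (q x - I / h) ^ 2 ≤ h * D := by
    intro x hx
    -- The deviation from the mean is the average over y of q x − q y.
    have e : ∫ y in a..(a + h), (q x - q y) = h * (q x - I / h) := by
      rw [intervalIntegral.integral_sub (continuous_const.intervalIntegrable _ _)
        (hqc.intervalIntegrable _ _), intervalIntegral.integral_const, ← hI]
      simp only [smul_eq_mul]
      field_simp
      ring
    have h1 := sq_intervalIntegral_le (f := fun y => q x - q y) (by fun_prop) hab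
    rw [e] at h1
    have h2 : ∫ y in a..(a + h), (q x - q y) ^ 2 ≤ ∫ y in a..(a + h), h * D := by
      refine intervalIntegral.integral_mono_on hab
        (Continuous.intervalIntegrable (by fun_prop) _ _)
        (continuous_const.intervalIntegrable _ _) fun y hy => ?_
      have := sq_sub_le_of_hasDerivAt hq hq' hab hx hy
      rwa [add_sub_cancel_left] at this
    rw [intervalIntegral.integral_const, add_sub_cancel_left, smul_eq_mul] at h2
    rw [add_sub_cancel_left] at h1
    have h3 : h ^ 2 * (q x - I / h) ^ 2 ≤ h ^ 2 * (h * D) := by nlinarith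
    exact le_of_mul_le_mul_left h3 (by positivity)
  have h4 : ∫ x in a..(a + h), (q x - I / h) ^ 2 ≤ ∫ x in a..(a + h), h * D :=
    intervalIntegral.integral_mono_on hab (Continuous.intervalIntegrable (by fun_prop) _ _)
        (continuous_const.intervalIntegrable _ _) hpt
  rw [intervalIntegral.integral_const, add_sub_cancel_left, smul_eq_mul] at h4
  have h5 : ∫ x in a..(a + h), (q x - I / h) ^ 2
      = (∫ x in a..(a + h), q x ^ 2) - I ^ 2 / h := by
    have e : (fun x => (q x - I / h) ^ 2)
        = fun x => (q x ^ 2 - (2 * (I / h)) * q x) + (I / h) ^ 2 := by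
      funext x; ring
    rw [e, intervalIntegral.integral_add (Continuous.intervalIntegrable (by fun_prop) _ _)
      (continuous_const.intervalIntegrable _ _),
      intervalIntegral.integral_sub (Continuous.intervalIntegrable (by fun_prop) _ _)
      (Continuous.intervalIntegrable (by fun_prop) _ _), intervalIntegral.integral_const_mul,
      intervalIntegral.integral_const, ← hI]
    simp only [smul_eq_mul, add_sub_cancel_left]
    field_simp
    ring
  rw [h5] at h4
  linarith

/-- A polynomial times `exp (-x ^ 2 / 2)`. -/
noncomputable def hermiteFn (p : Polynomial ℝ) (x : ℝ) : ℝ := p.eval x * Real.exp (-(1 / 2) * x ^ 2)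

theorem continuous_hermiteFn (p : Polynomial ℝ) : Continuous (hermiteFn p) := by
  unfold hermiteFn
  have := p.continuous
  fun_prop

theorem hermiteFn_sq (p : Polynomial ℝ) (x : ℝ) :
    hermiteFn p x ^ 2 = (p * p).eval x * Real.exp (-1 * x ^ 2) := by
  rw [hermiteFn, mul_pow, sq (Real.exp _), ← Real.exp_add, Polynomial.eval_mul]
  ring_nf

theorem integrable_hermiteFn_sq (p : Polynomial ℝ) : Integrable fun x => hermiteFn p x ^ 2 := by
  simp_rw [hermiteFn_sq]
  exact integrable_eval_mul_exp _ one_pos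

theorem integral_hermiteFn_sq (p : Polynomial ℝ) : ∫ x, hermiteFn p x ^ 2 = gaussInt (p * p) := by
  simp_rw [hermiteFn_sq]
  rfl

theorem setIntegral_hermiteFn_sq_le (p : Polynomial ℝ) (S : Set ℝ) :
    ∫ x in S, hermiteFn p x ^ 2 ≤ gaussInt (p * p) := by
  rw [← integral_hermiteFn_sq]
  exact setIntegral_le_integral (integrable_hermiteFn_sq p)
    (Filter.Eventually.of_forall fun x => sq_nonneg _)

theorem intervalIntegral_hermiteFn_sq_le (p : Polynomial ℝ) {a b : ℝ} (hab : a ≤ b) :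
    ∫ x in a..b, hermiteFn p x ^ 2 ≤ gaussInt (p * p) := by
  rw [intervalIntegral.integral_of_le hab]
  exact setIntegral_hermiteFn_sq_le p _

open Polynomial in
theorem hasDerivAt_hermiteFn (p : ℝ[X]) (x : ℝ) :
    HasDerivAt (hermiteFn p) (hermiteFn (derivative p - X * p) x) x := by
  have h1 : HasDerivAt (fun x : ℝ => -(1 / 2) * x ^ 2) (-(1 / 2) * (2 * x)) x := by
    simpa using (hasDerivAt_pow 2 x).const_mul (-(1 / 2) : ℝ)
  refine ((p.hasDerivAt x).mul h1.exp).congr_deriv ?_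
  simp [hermiteFn]
  ring

/-- Pointwise bound for `hermiteFn p` in terms of the degree of `p`. -/
theorem hermiteFn_sq_le {k : ℕ} {p : Polynomial ℝ} (hp : p.natDegree ≤ k) (x : ℝ) {l : ℝ}
    (hl : 0 < l) :
    hermiteFn p x ^ 2 ≤ (2 * l * (2 * k + 1) + 2 / l) * gaussInt (p * p) := by
  have hxl : x ≤ x + l := by linarith
  have hD := (intervalIntegral_hermiteFn_sq_le (Polynomial.derivative p - Polynomial.X * p)
    hxl).trans (gaussInt_derivative_sub_X_mul_sq_le hp)
  have hc := continuous_hermiteFn p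
  have hpt : ∀ y ∈ Set.Icc x (x + l), hermiteFn p x ^ 2
      ≤ 2 * (l * ((2 * k + 1) * gaussInt (p * p))) + 2 * hermiteFn p y ^ 2 := by
    intro y hy
    have h := sq_sub_le_of_hasDerivAt (hasDerivAt_hermiteFn p) (continuous_hermiteFn _) hxl
      (Set.left_mem_Icc.2 hxl) hy
    rw [add_sub_cancel_left] at h
    have h2 := mul_le_mul_of_nonneg_left hD hl.le
    nlinarith [sq_nonneg (hermiteFn p x - 2 * hermiteFn p y)]
  have h1 := intervalIntegral.integral_mono_on (μ := volume) hxl (continuous_const.intervalIntegrable _ _)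
    (Continuous.intervalIntegrable (by fun_prop) _ _) hpt
  rw [intervalIntegral.integral_const, intervalIntegral.integral_add
    (continuous_const.intervalIntegrable _ _) (Continuous.intervalIntegrable (by fun_prop) _ _),
    intervalIntegral.integral_const, intervalIntegral.integral_const_mul, add_sub_cancel_left,
    smul_eq_mul, smul_eq_mul] at h1
  have h2 := intervalIntegral_hermiteFn_sq_le p hxl
  have h3 : l * hermiteFn p x ^ 2
      ≤ l * ((2 * l * (2 * k + 1) + 2 / l) * gaussInt (p * p)) := by
    have e : l * ((2 * l * (2 * k + 1) + 2 / l) * gaussInt (p * p))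
        = l * (2 * (l * ((2 * k + 1) * gaussInt (p * p)))) + 2 * gaussInt (p * p) := by
      field_simp
    rw [e]
    linarith
  exact le_of_mul_le_mul_left h3 hl

/-- No single cell carries much: the pointwise bound at length l = 64h makes q² at most 1/(16h) of
the total mass, uniformly. -/
theorem sq_intervalIntegral_hermiteFn_le {k : ℕ} {p : Polynomial ℝ} (hp : p.natDegree ≤ k) (a : ℝ)
    {h : ℝ} (hh : 0 < h) (hkh : (2 * k + 1) * h ^ 2 ≤ 1 / 4096) :
    (∫ z in a..(a + h), hermiteFn p z) ^ 2 ≤ h / 16 * gaussInt (p * p) := by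
  have hab : a ≤ a + h := by linarith
  have hc := continuous_hermiteFn p
  have h0 := gaussInt_mul_self_nonneg p
  have hpt : ∀ x, hermiteFn p x ^ 2 ≤ 1 / (16 * h) * gaussInt (p * p) := by
    intro x
    refine (hermiteFn_sq_le hp x (l := 64 * h) (by positivity)).trans
      (mul_le_mul_of_nonneg_right ?_ h0)
    have e1 : 2 * (64 * h) * (2 * (k : ℝ) + 1) = 128 * ((2 * k + 1) * h ^ 2) / h := by
      field_simp
      ring
    have e2 : 128 * ((2 * k + 1) * h ^ 2) / h ≤ 128 * (1 / 4096) / h := by gcongr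
    have e3 : 128 * (1 / 4096) / h + 2 / (64 * h) = 1 / (16 * h) := by
      field_simp
      norm_num
    rw [e1]
    linarith
  have h1 := sq_intervalIntegral_le hc hab
  have h2 := intervalIntegral.integral_mono_on (μ := volume) hab
    (Continuous.intervalIntegrable (by fun_prop) _ _)
    (continuous_const.intervalIntegrable _ _) (fun x _ => hpt x)
  rw [intervalIntegral.integral_const, smul_eq_mul] at h2
  rw [add_sub_cancel_left] at h1 h2
  calc _ ≤ h * ∫ z in a..(a + h), hermiteFn p z ^ 2 := h1
    _ ≤ h * (h * (1 / (16 * h) * gaussInt (p * p))) := by gcongr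
    _ = _ := by field_simp

/-- Markov's inequality: on S the weight (x²/R²)^m is at least 1, and multiplication by X^m is
bounded on polynomials of bounded degree. -/
theorem setIntegral_hermiteFn_sq_tail_le {k : ℕ} {p : Polynomial ℝ} (hp : p.natDegree ≤ k) (m : ℕ)
    {S : Set ℝ} (hS : MeasurableSet S) {R : ℝ} (hR : 0 < R) (hSR : ∀ z ∈ S, R ≤ |z|) :
    ∫ x in S, hermiteFn p x ^ 2 ≤ (2 * (k + m) / R ^ 2) ^ m * gaussInt (p * p) := by
  have h1 : ∫ x in S, hermiteFn p x ^ 2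
      ≤ ∫ x in S, (1 / R ^ 2) ^ m * hermiteFn (Polynomial.X ^ m * p) x ^ 2 := by
    refine setIntegral_mono_on (integrable_hermiteFn_sq p).integrableOn
      ((integrable_hermiteFn_sq _).const_mul _).integrableOn hS fun x hx => ?_
    have hx2 : R ^ 2 ≤ x ^ 2 := by
      rw [← sq_abs x]; exact pow_le_pow_left₀ hR.le (hSR x hx) 2
    have e : (1 / R ^ 2) ^ m * hermiteFn (Polynomial.X ^ m * p) x ^ 2
        = (x ^ 2 / R ^ 2) ^ m * hermiteFn p x ^ 2 := by
      simp only [hermiteFn, Polynomial.eval_mul, Polynomial.eval_pow, Polynomial.eval_X]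
      rw [div_pow, div_pow, ← pow_mul x, one_pow, mul_comm 2 m, pow_mul x]
      ring
    rw [e]
    refine le_mul_of_one_le_left (sq_nonneg _) (one_le_pow₀ ?_)
    rwa [one_le_div (by positivity)]
  rw [integral_const_mul] at h1
  have h2 := (setIntegral_hermiteFn_sq_le (Polynomial.X ^ m * p) S).trans
    (gaussInt_X_pow_mul_sq_le hp m)
  calc _ ≤ _ := h1
    _ ≤ (1 / R ^ 2) ^ m * ((2 * (k + m)) ^ m * gaussInt (p * p)) := by gcongr
    _ = _ := by rw [← mul_assoc, ← mul_pow]; congr 2; ring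

/-- On an unbounded set the constant 1 is not square integrable, so Cauchy–Schwarz is applied to (1
+ x²)p and (1 + x²)⁻¹ instead. -/
theorem sq_setIntegral_hermiteFn_tail_le {k : ℕ} {p : Polynomial ℝ} (hp : p.natDegree ≤ k) (m : ℕ)
    {S : Set ℝ} (hS : MeasurableSet S) {R : ℝ} (hR : 0 < R) (hSR : ∀ z ∈ S, R ≤ |z|) :
    (∫ x in S, hermiteFn p x) ^ 2
      ≤ 4 * (2 * (k + 2 + m) / R ^ 2) ^ m * (2 + 8 * (k + 2) ^ 2) * gaussInt (p * p) := by
  set r : Polynomial ℝ := p + Polynomial.X ^ 2 * p with hr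
  have hrdeg : r.natDegree ≤ k + 2 := by
    refine (Polynomial.natDegree_add_le _ _).trans (max_le (by omega) ?_)
    refine Polynomial.natDegree_mul_le.trans ?_
    rw [Polynomial.natDegree_X_pow]
    omega
  have hrr : gaussInt (r * r) ≤ (2 + 8 * (k + 2) ^ 2) * gaussInt (p * p) := by
    have h1 := gaussInt_add_sq_le p (Polynomial.X ^ 2 * p)
    have h2 := gaussInt_X_pow_mul_sq_le hp 2
    push_cast at h2
    have e : (2 * ((k : ℝ) + 2)) ^ 2 = 4 * (k + 2) ^ 2 := by ring
    rw [e] at h2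
    linarith
  have hw0 : Continuous fun x : ℝ => (1 + x ^ 2)⁻¹ :=
    Continuous.inv₀ (by fun_prop) fun x => by positivity
  have hw2 : ∀ x : ℝ, ((1 + x ^ 2)⁻¹) ^ 2 ≤ (1 + x ^ 2)⁻¹ := by
    intro x
    have h1 : (1 + x ^ 2)⁻¹ ≤ 1 := inv_le_one_of_one_le₀ (by nlinarith [sq_nonneg x])
    have h2 : 0 ≤ (1 + x ^ 2)⁻¹ := by positivity
    nlinarith
  have hwi : Integrable fun x : ℝ => ((1 + x ^ 2)⁻¹) ^ 2 :=
    integrable_inv_one_add_sq.mono' (by fun_prop) (Filter.Eventually.of_forall fun x => by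
      rw [Real.norm_of_nonneg (by positivity)]; exact hw2 x)
  have hwS : ∫ x in S, ((1 + x ^ 2)⁻¹) ^ 2 ≤ 4 := by
    calc _ ≤ ∫ x : ℝ, ((1 + x ^ 2)⁻¹) ^ 2 := setIntegral_le_integral hwi
          (Filter.Eventually.of_forall fun x => sq_nonneg _)
      _ ≤ ∫ x : ℝ, (1 + x ^ 2)⁻¹ := integral_mono hwi integrable_inv_one_add_sq hw2
      _ = Real.pi := integral_univ_inv_one_add_sq
      _ ≤ 4 := Real.pi_le_four
  have hcs := sq_integral_mul_le (μ := volume.restrict S) (f := hermiteFn r)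
    (g := fun x => (1 + x ^ 2)⁻¹)
    ((memLp_two_iff_integrable_sq (continuous_hermiteFn r).aestronglyMeasurable).2
      (integrable_hermiteFn_sq r).integrableOn)
    ((memLp_two_iff_integrable_sq hw0.aestronglyMeasurable).2 hwi.integrableOn)
  have e : ∀ x, hermiteFn r x * (1 + x ^ 2)⁻¹ = hermiteFn p x := by
    intro x
    have : (1 + x ^ 2) ≠ 0 := by positivity
    simp only [hermiteFn, hr, Polynomial.eval_add, Polynomial.eval_mul, Polynomial.eval_pow,
      Polynomial.eval_X]
    field_simp
  simp_rw [e] at hcs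
  have h3 := setIntegral_hermiteFn_sq_tail_le hrdeg m hS hR hSR
  push_cast at h3
  have h0 := gaussInt_mul_self_nonneg r
  calc _ ≤ _ := hcs
    _ ≤ ((2 * (k + 2 + m) / R ^ 2) ^ m * ((2 + 8 * (k + 2) ^ 2) * gaussInt (p * p))) * 4 := by
        refine mul_le_mul (h3.trans ?_) hwS
          (integral_nonneg fun x => sq_nonneg _) ?_
        · gcongr
        · have := gaussInt_mul_self_nonneg p
          positivity
    _ = _ := by ring

/-- The `L²` norm of `hermiteFn p` is controlled by its integrals over the cells of a fine grid. -/
theorem gaussInt_le_sum_sq_intervalIntegral {k : ℕ} {p : Polynomial ℝ} (hp : p.natDegree ≤ k)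
    {h R : ℝ} (hh : 0 < h) (hkh : (2 * k + 1) * h ^ 2 ≤ 1 / 4096) {M : ℕ} (hM : M * h = 2 * R)
    (hR : 0 < R) {m : ℕ} (hm : (2 * (k + m) / R ^ 2) ^ m ≤ 1 / 4) :
    gaussInt (p * p) ≤ 2 / h * ∑ j ∈ Finset.range M,
      (∫ z in (-R + j * h)..(-R + j * h + h), hermiteFn p z) ^ 2 := by
  have h0 := gaussInt_mul_self_nonneg p
  set q := hermiteFn p
  set q' := hermiteFn (Polynomial.derivative p - Polynomial.X * p)
  have hqc : Continuous q := continuous_hermiteFn p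
  have hq'c : Continuous q' := continuous_hermiteFn _
  have hadj : ∀ f : ℝ → ℝ, Continuous f → ∑ j ∈ Finset.range M,
      ∫ z in (-R + j * h)..(-R + j * h + h), f z = ∫ z in (-R)..R, f z := by
    intro f hf
    have := intervalIntegral.sum_integral_adjacent_intervals (μ := volume) (f := f) (n := M)
      (a := fun j : ℕ => -R + j * h) (fun j _ => hf.intervalIntegrable _ _)
    have e0 : -R + M * h = R := by rw [hM]; ring
    simp only [Nat.cast_zero, zero_mul, add_zero, e0] at this
    rw [← this]
    refine Finset.sum_congr rfl fun j _ => ?_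
    congr 1
    push_cast
    ring
  have h1 : ∫ z in (-R)..R, q z ^ 2 ≤ (∑ j ∈ Finset.range M,
      (∫ z in (-R + j * h)..(-R + j * h + h), q z) ^ 2) / h
      + h ^ 2 * ∫ z in (-R)..R, q' z ^ 2 := by
    rw [← hadj (fun z => q z ^ 2) (hqc.pow 2), ← hadj (fun z => q' z ^ 2) (hq'c.pow 2), Finset.sum_div, Finset.mul_sum,
      ← Finset.sum_add_distrib]
    exact Finset.sum_le_sum fun j _ => intervalIntegral_sq_le (hasDerivAt_hermiteFn p) hq'c _ hh
  have h2 : h ^ 2 * ∫ z in (-R)..R, q' z ^ 2 ≤ 1 / 4096 * gaussInt (p * p) := by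
    have := (intervalIntegral_hermiteFn_sq_le (Polynomial.derivative p - Polynomial.X * p)
      (by linarith : -R ≤ R)).trans (gaussInt_derivative_sub_X_mul_sq_le hp)
    calc _ ≤ h ^ 2 * ((2 * k + 1) * gaussInt (p * p)) := by gcongr
      _ = ((2 * k + 1) * h ^ 2) * gaussInt (p * p) := by ring
      _ ≤ _ := by gcongr
  have h3 : ∫ z in (Set.Ioc (-R) R)ᶜ, q z ^ 2 ≤ 1 / 4 * gaussInt (p * p) := by
    refine (setIntegral_hermiteFn_sq_tail_le hp m measurableSet_Ioc.compl hR fun z hz => ?_).trans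
      (by gcongr)
    rw [Set.mem_compl_iff, Set.mem_Ioc, not_and_or, not_lt, not_le] at hz
    rcases hz with hz | hz
    · exact le_abs.2 (Or.inr (by linarith))
    · exact le_abs.2 (Or.inl hz.le)
  have h4 := integral_add_compl (measurableSet_Ioc (a := -R) (b := R)) (integrable_hermiteFn_sq p)
  rw [integral_hermiteFn_sq, ← intervalIntegral.integral_of_le (by linarith)] at h4
  set T := ∑ j ∈ Finset.range M, (∫ z in (-R + j * h)..(-R + j * h + h), q z) ^ 2
  -- The tail and the Poincaré error take at most 1/4 + 1/4096 < 1/2 of the mass.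
  have h5 : gaussInt (p * p) ≤ 2 * (T / h) := by linarith
  calc _ ≤ _ := h5
    _ = _ := by ring

/-! ### Classifiers that cut a line into cells -/

/-- The number of the thresholds `b, b + h, …, b + (N - 1) h` that lie below `z`. -/
noncomputable def cellIdx (b h : ℝ) (N : ℕ) (z : ℝ) : ℕ :=
  ((Finset.range N).filter fun l : ℕ => b + l * h < z).card

theorem cellIdx_le (b h : ℝ) (N : ℕ) (z : ℝ) : cellIdx b h N z ≤ N :=
  (Finset.card_filter_le _ _).trans_eq (Finset.card_range N)

theorem lt_cellIdx_iff (b : ℝ) {h : ℝ} (hh : 0 ≤ h) (N : ℕ) (z : ℝ) (j : ℕ) :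
    j < cellIdx b h N z ↔ j < N ∧ b + j * h < z := by
  constructor
  · intro hj
    have hjN := lt_of_lt_of_le hj (cellIdx_le b h N z)
    refine ⟨hjN, ?_⟩
    by_contra hcon
    have hsub : ((Finset.range N).filter fun l : ℕ => b + l * h < z) ⊆ Finset.range j := by
      intro l hl
      rw [Finset.mem_filter] at hl
      rw [Finset.mem_range]
      by_contra hlj
      have : (j : ℝ) ≤ l := by exact_mod_cast not_lt.1 hlj
      nlinarith [mul_le_mul_of_nonneg_right this hh]
    have := Finset.card_le_card hsub
    rw [Finset.card_range] at this
    exact absurd hj (not_lt.2 this)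
  · rintro ⟨hjN, hz⟩
    have hsub : Finset.range (j + 1) ⊆ (Finset.range N).filter fun l : ℕ => b + l * h < z := by
      intro l hl
      rw [Finset.mem_range] at hl
      rw [Finset.mem_filter, Finset.mem_range]
      have : (l : ℝ) ≤ j := by exact_mod_cast Nat.le_of_lt_succ hl
      exact ⟨by omega, by nlinarith [mul_le_mul_of_nonneg_right this hh]⟩
    have := Finset.card_le_card hsub
    rw [Finset.card_range] at this
    exact this

/-- The cell of `z` in the partition of the line by the thresholds `b, b + h, …`. -/
noncomputable def cell (b h : ℝ) (N : ℕ) (z : ℝ) : Fin (N + 1) :=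
  ⟨cellIdx b h N z, Nat.lt_succ_of_le (cellIdx_le b h N z)⟩

theorem measurable_cell (b h : ℝ) (N : ℕ) : Measurable (cell b h N) := by
  have h1 : Measurable (cellIdx b h N) := by
    have : cellIdx b h N = fun z => ∑ l ∈ Finset.range N, if b + l * h < z then 1 else 0 := by
      funext z
      rw [cellIdx, Finset.card_filter]
    rw [this]
    exact Finset.measurable_sum _ fun l _ =>
      Measurable.ite measurableSet_Ioi measurable_const measurable_const
  refine measurable_to_countable' fun j => ?_
  have : cell b h N ⁻¹' {j} = cellIdx b h N ⁻¹' {(j : ℕ)} := by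
    ext z
    simp [cell, Fin.ext_iff]
  rw [this]
  exact h1 (measurableSet_singleton _)

/-- Score j is the sum of z − θ_l over the first j thresholds θ_l. It increases as long as θ_l < z,
so the maximum is at the number of thresholds below z. Counting thresholds strictly below z agrees
with breaking ties by the smallest index. -/
theorem cell_inner_mem_linearClassifiers (b : ℝ) {h : ℝ} (hh : 0 ≤ h) (N : ℕ) {d : ℕ}
    (v : EuclideanSpace ℝ (Fin d)) :
    (fun x => cell b h N (inner ℝ v x)) ∈ linearClassifiers d (N + 1) := by
  refine ⟨fun j => (j : ℝ) • v, fun j => -∑ l ∈ Finset.range j, (b + l * h), fun x => ?_⟩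
  set z : ℝ := inner ℝ v x with hz
  set c := cell b h N z with hc
  have hscore : ∀ j : Fin (N + 1), inner ℝ ((j : ℝ) • v) x + -∑ l ∈ Finset.range j, (b + l * h)
      = ∑ l ∈ Finset.range j, (z - (b + l * h)) := by
    intro j
    rw [Finset.sum_sub_distrib, inner_smul_left, ← hz]
    simp
    ring
  simp only [hscore]
  have hlow : ∀ j : Fin (N + 1), j < c → ∑ l ∈ Finset.range j, (z - (b + l * h))
      < ∑ l ∈ Finset.range c, (z - (b + l * h)) := by
    intro j hj
    rw [← sub_pos, ← Finset.sum_Ico_eq_sub _ (Fin.le_def.1 hj.le)]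
    refine Finset.sum_pos (fun l hl => ?_) (Finset.nonempty_Ico.2 hj)
    have := ((lt_cellIdx_iff b hh N z l).1 (Finset.mem_Ico.1 hl).2).2
    linarith
  have hhigh : ∀ j : Fin (N + 1), c ≤ j → ∑ l ∈ Finset.range j, (z - (b + l * h))
      ≤ ∑ l ∈ Finset.range c, (z - (b + l * h)) := by
    intro j hj
    rw [← sub_nonpos, ← Finset.sum_Ico_eq_sub _ (Fin.le_def.1 hj)]
    refine Finset.sum_nonpos fun l hl => ?_
    rw [Finset.mem_Ico] at hl
    have h1 : ¬ l < cellIdx b h N z := not_lt.2 hl.1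
    rw [lt_cellIdx_iff b hh, not_and, not_lt] at h1
    have := h1 (by omega)
    linarith
  refine ⟨fun j => ?_, hlow⟩
  rcases lt_or_ge j c with hj | hj
  · exact (hlow j hj).le
  · exact hhigh j hj

theorem integral_comp_mul_eq_sum {K : ℕ} {F : ℝ → Fin K} (hF : Measurable F) (a : Fin K → ℝ)
    {μ : Measure ℝ} {g : ℝ → ℝ} (hg : Integrable g μ) :
    ∫ z, a (F z) * g z ∂μ = ∑ i, a i * ∫ z in F ⁻¹' {i}, g z ∂μ := by
  have hS : ∀ i, MeasurableSet (F ⁻¹' {i}) := fun i => hF (measurableSet_singleton i)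
  have e : (fun z => a (F z) * g z) = fun z => ∑ i, a i * (F ⁻¹' {i}).indicator g z := by
    funext z
    rw [Finset.sum_eq_single (F z)]
    · simp
    · intro i _ hi
      rw [Set.indicator_of_notMem (by simpa using hi.symm), mul_zero]
    · simp
  rw [e, integral_finsetSum _ fun i _ => (hg.indicator (hS i)).const_mul _]
  refine Finset.sum_congr rfl fun i _ => ?_
  rw [integral_const_mul, integral_indicator (hS i)]

/-! ### Perturbations of the uniform confusion matrix with matching moments -/

/-- A perturbation `E` of the uniform confusion matrix such that the labels are uncorrelated with
all polynomials of degree `< n` of the projection on the hidden direction. -/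
structure IsMomentMatching {K : ℕ} (n : ℕ) (F : ℝ → Fin K) (E : Fin K → Fin K → ℝ) : Prop where
  entry_le : ∀ i j, |E i j| ≤ 3
  row_sum : ∀ i, ∑ j, E i j = 0
  diag : ∀ i j, j ≠ i → E i j + 1 / 2 ≤ E i i
  moment : ∀ t < n, ∀ j, ∫ z, E (F z) j * z ^ t ∂(gaussianReal 0 1) = 0
  gap : 1 / 8 ≤ ∫ z, E (F z) (F z) ∂(gaussianReal 0 1)

theorem gaussianReal_Ioi_zero_le : (gaussianReal 0 1).real (Set.Ioi 0) ≤ 1 / 2 ∧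
    (gaussianReal 0 1).real (Set.Iic 0) ≤ 1 / 2 := by
  have := nullSingletonClass_gaussianReal (μ := 0) (v := 1) one_ne_zero
  have h1 : (gaussianReal 0 1).real (Set.Ioi 0) = (gaussianReal 0 1).real (Set.Iio 0) := by
    have h : (gaussianReal 0 1).map (fun x => -x) = gaussianReal 0 1 := by
      rw [gaussianReal_map_neg, neg_zero]
    conv_lhs => rw [← h]
    rw [measureReal_def, Measure.map_apply measurable_neg measurableSet_Ioi, measureReal_def]
    congr 2
    ext x
    simp
  have h2 : (gaussianReal 0 1).real (Set.Iic 0) = (gaussianReal 0 1).real (Set.Iio 0) := by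
    rw [measureReal_def, measureReal_def, measure_congr Iio_ae_eq_Iic]
  have h3 := probReal_compl_eq_one_sub (μ := gaussianReal 0 1) (measurableSet_Ioi (a := (0 : ℝ)))
  rw [Set.compl_Ioi] at h3
  constructor <;> linarith

/-- Covers small K. With m the cell masses, E i j = δ_ij − m_j has columns of mean zero. The
threshold at 0 keeps every mass at most 1/2, as the diagonal needs. -/
theorem exists_isMomentMatching_one {N : ℕ} (hN : 1 ≤ N) :
    ∃ E, IsMomentMatching 1 (cell 0 1 N) E := by
  set F := cell 0 1 N
  have hF : Measurable F := measurable_cell 0 1 N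
  set m : Fin (N + 1) → ℝ := fun i => (gaussianReal 0 1).real (F ⁻¹' {i}) with hm
  have hm0 : ∀ i, 0 ≤ m i := fun i => measureReal_nonneg
  have hmhalf : ∀ i, m i ≤ 1 / 2 := by
    intro i
    have hidx : ∀ z, (F z : ℕ) = 0 ↔ z ≤ 0 := by
      intro z
      have := lt_cellIdx_iff 0 zero_le_one N z 0
      simp only [Nat.cast_zero, zero_mul, add_zero] at this
      rw [← not_lt, ← Nat.pos_iff_ne_zero.not_left]
      constructor
      · intro h h'
        exact h (this.2 ⟨by omega, h'⟩)
      · intro h h'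
        exact h (this.1 h').2
    by_cases hi : (i : ℕ) = 0
    · refine le_trans (measureReal_mono ?_) gaussianReal_Ioi_zero_le.2
      rintro z rfl
      exact (hidx z).1 hi
    · refine le_trans (measureReal_mono ?_) gaussianReal_Ioi_zero_le.1
      rintro z rfl
      exact not_le.1 fun h => hi ((hidx z).2 h)
  have hset : ∀ i, ∫ z in F ⁻¹' {i}, (1 : ℝ) ∂(gaussianReal 0 1) = m i := by
    intro i; simp [hm]
  have hmsum : ∑ i, m i = 1 := by
    have := integral_comp_mul_eq_sum hF (fun _ => 1) (μ := gaussianReal 0 1)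
      (integrable_const (1 : ℝ))
    simp only [hset] at this
    simpa using this.symm
  have hcomp : ∀ a : Fin (N + 1) → ℝ, ∫ z, a (F z) ∂(gaussianReal 0 1) = ∑ i, a i * m i := by
    intro a
    have := integral_comp_mul_eq_sum hF a (μ := gaussianReal 0 1) (integrable_const (1 : ℝ))
    simpa only [hset, mul_one] using this
  refine ⟨fun i j => (if i = j then 1 else 0) - m j, ?_, ?_, ?_, ?_, ?_⟩
  · intro i j
    have h1 := hm0 j
    have h2 := hmhalf j
    rw [abs_le]
    split_ifs <;> constructor <;> linarith
  · intro i
    rw [Finset.sum_sub_distrib, hmsum]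
    simp
  · intro i j hij
    have h1 := hm0 j
    have h2 := hmhalf i
    rw [if_neg hij.symm, if_pos rfl]
    linarith
  · intro t ht j
    rw [Nat.lt_one_iff.1 ht]
    simp only [pow_zero, mul_one]
    rw [hcomp fun i => (if i = j then 1 else 0) - m j]
    simp [sub_mul, Finset.sum_sub_distrib, ← Finset.mul_sum, hmsum]
  · simp only [if_true]
    rw [hcomp fun i => 1 - m i]
    calc (1 / 8 : ℝ) ≤ ∑ i, (1 / 2) * m i := by rw [← Finset.mul_sum, hmsum]; norm_num
      _ ≤ _ := Finset.sum_le_sum fun i _ =>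
        mul_le_mul_of_nonneg_right (by linarith [hmhalf i]) (hm0 i)

/-- The vector of the Gaussian integrals of a polynomial over the fibres of `F`. -/
noncomputable def fibreIntegrals {K : ℕ} (F : ℝ → Fin K) :
    Polynomial ℝ →ₗ[ℝ] EuclideanSpace ℝ (Fin K) where
  toFun p := WithLp.toLp 2 fun i => ∫ z in F ⁻¹' {i}, p.eval z ∂(gaussianReal 0 1)
  map_add' p q := by
    have hi : ∀ p : Polynomial ℝ, Integrable (fun z => p.eval z) (gaussianReal 0 1) := by
      intro p
      simp_rw [Polynomial.eval_eq_sum_range]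
      exact integrable_finsetSum _ fun i _ => (integrable_pow_gaussianReal i).const_mul _
    ext i
    simp only [Polynomial.eval_add, PiLp.add_apply]
    exact integral_add (hi p).integrableOn (hi q).integrableOn
  map_smul' c p := by
    ext i
    simp [integral_const_mul]

/-- E is I − P with row means removed, P being the projection onto the cell integrals of polynomials
of degree < n. The hypothesis says that P has diagonal entries, and hence all entries, at most 1/8
in absolute value. -/
theorem exists_isMomentMatching_of_leverage {K n : ℕ} (hn : 1 ≤ n) {F : ℝ → Fin K}
    (hF : Measurable F) (hlev : ∀ p : Polynomial ℝ, p.natDegree < n → ∀ i,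
      8 * (fibreIntegrals F p i) ^ 2 ≤ ‖fibreIntegrals F p‖ ^ 2) :
    ∃ E, IsMomentMatching n F E := by
  classical
  set A : Submodule ℝ (EuclideanSpace ℝ (Fin K)) :=
    (Polynomial.degreeLT ℝ n).map (fibreIntegrals F) with hA
  set e : Fin K → EuclideanSpace ℝ (Fin K) := fun i => EuclideanSpace.single i 1 with he
  set P := A.starProjection with hP
  have hmem : ∀ x, P x ∈ A := fun x => Submodule.starProjection_apply_mem A x
  have hKpos : 0 < K := (Nat.zero_le _).trans_lt (F 0).2
  have hK' : (0 : ℝ) < K := by exact_mod_cast hKpos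
  have horth : ∀ j, ∀ a ∈ A, inner ℝ (e j - P (e j)) a = 0 := by
    intro j a ha
    rw [real_inner_comm]
    exact (Submodule.sub_starProjection_mem_orthogonal (K := A) (e j)) a ha
  have hpow : ∀ t < n, fibreIntegrals F (Polynomial.X ^ t) ∈ A := by
    intro t ht
    refine Submodule.mem_map_of_mem (Polynomial.mem_degreeLT.2 ?_)
    rw [Polynomial.degree_X_pow]
    exact_mod_cast ht
  -- The hypothesis is applied to the vector P e_i itself, whose i-th coordinate equals ‖P e_i‖².
  have hnorm : ∀ i, ‖P (e i)‖ ^ 2 ≤ 1 / 8 := by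
    intro i
    obtain ⟨p, hp, hpe⟩ := Submodule.mem_map.1 (hmem (e i))
    have hdeg : p.natDegree < n := by
      rw [Polynomial.mem_degreeLT] at hp
      by_cases hp0 : p = 0
      · rw [hp0, Polynomial.natDegree_zero]; omega
      · exact (Polynomial.natDegree_lt_iff_degree_lt hp0).2 hp
    have h1 := hlev p hdeg i
    rw [hpe] at h1
    have h2 : inner ℝ (e i) (P (e i)) = ‖P (e i)‖ ^ 2 := by
      have := horth i _ (hmem (e i))
      rw [inner_sub_left, real_inner_self_eq_norm_sq] at this
      linarith
    have h3 : inner ℝ (e i) (P (e i)) = (P (e i)) i := by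
      simp [he, EuclideanSpace.inner_single_left]
    rw [h3] at h2
    rw [h2] at h1
    nlinarith [sq_nonneg (‖P (e i)‖)]
  have hent : ∀ i j, |(P (e j)) i| ≤ 1 / 8 := by
    intro i j
    have h3 : inner ℝ (e i) (P (e j)) = (P (e j)) i := by
      simp [he, EuclideanSpace.inner_single_left]
    have h4 : inner ℝ (e i) (P (e j)) = inner ℝ (P (e i)) (P (e j)) := by
      have := horth i _ (hmem (e j))
      rw [inner_sub_left] at this
      linarith
    rw [← h3, h4]
    have h5 := abs_real_inner_le_norm (P (e i)) (P (e j))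
    nlinarith [hnorm i, hnorm j, sq_nonneg (‖P (e i)‖ - ‖P (e j)‖)]
  set x : Fin K → Fin K → ℝ := fun i j => (e j - P (e j)) i with hx
  have hxe : ∀ i j, x i j = (if i = j then 1 else 0) - (P (e j)) i := by
    intro i j
    simp [hx, he]
  have hxabs : ∀ i j, |x i j| ≤ 9 / 8 := by
    intro i j
    have := abs_le.1 (hent i j)
    rw [hxe, abs_le]
    split_ifs <;> constructor <;> linarith
  have hcol : ∀ t < n, ∀ j, ∑ i, x i j * fibreIntegrals F (Polynomial.X ^ t) i = 0 := by
    intro t ht j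
    have := horth j _ (hpow t ht)
    rw [PiLp.inner_apply] at this
    simpa [hx, mul_comm] using this
  -- The vector of row means is an average of the columns, so it is orthogonal to A as well, and
  -- subtracting it spoils no moment.
  set r : Fin K → ℝ := fun i => (∑ j, x i j) / K with hr
  have hrabs : ∀ i, |r i| ≤ 9 / 8 := by
    intro i
    rw [hr, abs_div, Nat.abs_cast, div_le_iff₀ hK']
    calc |∑ j, x i j| ≤ ∑ j, |x i j| := Finset.abs_sum_le_sum_abs _ _
      _ ≤ ∑ j : Fin K, (9 / 8 : ℝ) := Finset.sum_le_sum fun j _ => hxabs i j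
      _ = _ := by simp; ring
  have hrcol : ∀ t < n, ∑ i, r i * fibreIntegrals F (Polynomial.X ^ t) i = 0 := by
    intro t ht
    simp only [hr, div_mul_eq_mul_div, ← Finset.sum_div, Finset.sum_mul]
    rw [Finset.sum_comm, Finset.sum_eq_zero fun j _ => hcol t ht j, zero_div]
  have hfib : ∀ t i, fibreIntegrals F (Polynomial.X ^ t) i
      = ∫ z in F ⁻¹' {i}, z ^ t ∂(gaussianReal 0 1) := by
    intro t i
    simp [fibreIntegrals]
  refine ⟨fun i j => x i j - r i, ?_, ?_, ?_, ?_, ?_⟩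
  · intro i j
    have h1 := abs_le.1 (hxabs i j)
    have h2 := abs_le.1 (hrabs i)
    rw [abs_le]
    constructor <;> linarith
  · intro i
    rw [Finset.sum_sub_distrib]
    simp only [hr, Finset.sum_const, Finset.card_univ, Fintype.card_fin, nsmul_eq_mul]
    field_simp
    ring
  · intro i j hij
    have h1 := abs_le.1 (hent i j)
    have h2 := abs_le.1 (hent i i)
    rw [hxe, hxe, if_neg hij.symm, if_pos rfl]
    linarith
  · intro t ht j
    rw [integral_comp_mul_eq_sum hF (fun i => x i j - r i) (integrable_pow_gaussianReal t)]
    simp only [sub_mul, Finset.sum_sub_distrib, ← hfib]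
    rw [hcol t ht j, hrcol t ht, sub_zero]
  · have h1 := integral_comp_mul_eq_sum hF (fun i => x i i - r i)
      (integrable_pow_gaussianReal 0)
    simp only [← hfib, sub_mul, Finset.sum_sub_distrib] at h1
    -- The cell masses form the moment vector for t = 0, so the row means do not affect the gap;
    -- this needs n ≥ 1.
    rw [hrcol 0 (by omega), sub_zero] at h1
    have h2 := integral_comp_mul_eq_sum hF (fun _ => 7 / 8) (integrable_pow_gaussianReal 0)
    simp only [← hfib] at h2
    simp only [pow_zero, mul_one, integral_const, probReal_univ, smul_eq_mul, one_mul] at h1 h2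
    rw [h1]
    have h3 : ∀ i, 0 ≤ fibreIntegrals F 1 i := by
      intro i
      have := hfib 0 i
      simp only [pow_zero] at this
      rw [this]
      exact integral_nonneg fun _ => zero_le_one
    calc (1 / 8 : ℝ) ≤ 7 / 8 := by norm_num
      _ = _ := h2
      _ ≤ _ := Finset.sum_le_sum fun i _ => mul_le_mul_of_nonneg_right (by
        have := abs_le.1 (hent i i)
        rw [hxe, if_pos rfl]
        linarith) (h3 i)

/-- The Gaussian density supplies the factor exp(-z²/2), so cell integrals of p become Lebesgue
integrals of `hermiteFn p`. -/
theorem fibreIntegrals_apply {K : ℕ} {F : ℝ → Fin K} (hF : Measurable F) (p : Polynomial ℝ)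
    (i : Fin K) : fibreIntegrals F p i
      = (Real.sqrt (2 * Real.pi))⁻¹ * ∫ z in F ⁻¹' {i}, hermiteFn p z := by
  have hS : MeasurableSet (F ⁻¹' {i}) := hF (measurableSet_singleton i)
  change ∫ z in F ⁻¹' {i}, p.eval z ∂(gaussianReal 0 1) = _
  rw [← integral_indicator hS, integral_gaussianReal_eq_integral_smul one_ne_zero,
    ← integral_const_mul, ← integral_indicator hS]
  refine integral_congr_ae (Filter.Eventually.of_forall fun z => ?_)
  by_cases hz : z ∈ F ⁻¹' {i}
  · simp only [Set.indicator_of_mem hz, smul_eq_mul, gaussianPDFReal, hermiteFn, NNReal.coe_one,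
      mul_one, sub_zero]
    have : -z ^ 2 / 2 = -(1 / 2) * z ^ 2 := by ring
    rw [this]
    ring
  · simp [Set.indicator_of_notMem hz]

/-- A grid with `M` cells of width `h` that is fine and long enough for polynomials of degree at
most `k`. -/
theorem leverage_cell {k M : ℕ} {h R : ℝ} (hh : 0 < h) (hR : 0 < R) (hM : M * h = 2 * R)
    (hkh : (2 * k + 1) * h ^ 2 ≤ 1 / 4096) {m : ℕ} (hm : (2 * (k + m) / R ^ 2) ^ m ≤ 1 / 4)
    (hm2 : 4 * (2 * (k + 2 + m) / R ^ 2) ^ m * (2 + 8 * ((k : ℝ) + 2) ^ 2) ≤ h / 16)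
    {p : Polynomial ℝ} (hp : p.natDegree ≤ k) (i : Fin (M + 2)) :
    8 * (fibreIntegrals (cell (-R) h (M + 1)) p i) ^ 2
      ≤ ‖fibreIntegrals (cell (-R) h (M + 1)) p‖ ^ 2 := by
  set F := cell (-R) h (M + 1) with hFdef
  have hF : Measurable F := measurable_cell _ _ _
  set a : Fin (M + 2) → ℝ := fun i => ∫ z in F ⁻¹' {i}, hermiteFn p z with ha
  suffices H : ∀ i, 8 * a i ^ 2 ≤ ∑ j, a j ^ 2 by
    rw [EuclideanSpace.real_norm_sq_eq]
    simp_rw [fibreIntegrals_apply hF, mul_pow]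
    rw [← Finset.mul_sum]
    have := mul_le_mul_of_nonneg_left (H i) (sq_nonneg (Real.sqrt (2 * Real.pi))⁻¹)
    linarith
  have h0 := gaussInt_mul_self_nonneg p
  -- Labels 0 and M + 1 are the two unbounded cells; the j-th bounded cell has label j + 1.
  have hint : ∀ j (hj : j < M), a ⟨j + 1, by omega⟩
      = ∫ z in (-R + j * h)..(-R + j * h + h), hermiteFn p z := by
    intro j hj
    rw [intervalIntegral.integral_of_le (by linarith)]
    simp only [ha]
    congr 2
    ext z
    have h1 := lt_cellIdx_iff (-R) hh.le (M + 1) z j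
    have h2 := lt_cellIdx_iff (-R) hh.le (M + 1) z (j + 1)
    push_cast at h2
    simp only [Set.mem_preimage, Set.mem_singleton_iff, hFdef, cell, Fin.ext_iff, Set.mem_Ioc]
    constructor
    · intro h
      rw [h] at h1 h2
      refine ⟨(h1.1 (by omega)).2, ?_⟩
      by_contra hcon
      have := h2.2 ⟨by omega, by linarith⟩
      omega
    · rintro ⟨hz1, hz2⟩
      have := h1.2 ⟨by omega, hz1⟩
      have h4 : ¬ j + 1 < cellIdx (-R) h (M + 1) z := by
        rw [h2]
        rintro ⟨_, h5⟩
        linarith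
      omega
  have hsum : ∑ j ∈ Finset.range M, (∫ z in (-R + j * h)..(-R + j * h + h), hermiteFn p z) ^ 2
      ≤ ∑ j, a j ^ 2 := by
    rw [Fin.sum_univ_succ, Fin.sum_univ_castSucc, ← Fin.sum_univ_eq_sum_range
      (fun j => (∫ z in (-R + j * h)..(-R + j * h + h), hermiteFn p z) ^ 2)]
    have : ∑ j : Fin M, (∫ z in (-R + (j : ℕ) * h)..(-R + (j : ℕ) * h + h), hermiteFn p z) ^ 2
        = ∑ j : Fin M, a j.castSucc.succ ^ 2 := by
      refine Finset.sum_congr rfl fun j _ => ?_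
      rw [← hint j j.2]
      rfl
    rw [this]
    nlinarith [sq_nonneg (a 0), sq_nonneg (a (Fin.last M).succ)]
  have hN := (gaussInt_le_sum_sq_intervalIntegral hp hh hkh hM hR hm).trans
    (mul_le_mul_of_nonneg_left hsum (by positivity))
  -- The product (h/16)(2/h) is the required 1/8.
  have hfin : ∀ i, a i ^ 2 ≤ h / 16 * gaussInt (p * p) → 8 * a i ^ 2 ≤ ∑ j, a j ^ 2 := by
    intro i hi
    have h3 := hi.trans (mul_le_mul_of_nonneg_left hN (by positivity))
    have e : h / 16 * (2 / h * ∑ j, a j ^ 2) = (∑ j, a j ^ 2) / 8 := by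
      field_simp
      ring
    rw [e] at h3
    linarith
  have htail : ∀ i, (∀ z ∈ F ⁻¹' {i}, R ≤ |z|) → a i ^ 2 ≤ h / 16 * gaussInt (p * p) := by
    intro i hi
    exact (sq_setIntegral_hermiteFn_tail_le hp m (hF (measurableSet_singleton i)) hR hi).trans
      (by gcongr)
  intro i
  refine hfin i ?_
  have hz : ∀ z ∈ F ⁻¹' {i}, cellIdx (-R) h (M + 1) z = i := by
    rintro z rfl
    rfl
  rcases Nat.eq_zero_or_pos i with hi0 | hi0
  · refine htail i fun z hzi => ?_
    have h1 := lt_cellIdx_iff (-R) hh.le (M + 1) z 0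
    rw [hz z hzi, hi0] at h1
    simp only [lt_irrefl, false_iff, not_and, not_lt, Nat.cast_zero, zero_mul, add_zero] at h1
    exact le_abs.2 (Or.inr (by linarith [h1 (by omega)]))
  · rcases (Nat.lt_succ_iff_lt_or_eq.1 i.2) with hi1 | hi1
    · obtain ⟨j, hj⟩ : ∃ j, (i : ℕ) = j + 1 := ⟨i - 1, by omega⟩
      have hjM : j < M := by omega
      have e : i = ⟨j + 1, by omega⟩ := Fin.ext hj
      rw [e, hint j hjM]
      exact sq_intervalIntegral_hermiteFn_le hp _ hh hkh
    · refine htail i fun z hzi => ?_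
      have h1 := (lt_cellIdx_iff (-R) hh.le (M + 1) z M).1 (by rw [hz z hzi]; omega)
      exact le_abs.2 (Or.inl (by linarith [h1.2]))

/-- With n = k + 1, the width h is of order 1/√n, and M ≥ 1024 n cells then reach R² ≥ 32 n. The
tail exponent m = n makes the tails exponentially small in n. -/
theorem exists_grid_parameters : ∃ n₀ : ℕ, 1 ≤ n₀ ∧ ∀ k : ℕ, n₀ ≤ k + 1 → ∀ M : ℕ,
    1024 * (k + 1) ≤ M → ∃ h R : ℝ, 0 < h ∧ 0 < R ∧ M * h = 2 * R ∧
      (2 * k + 1) * h ^ 2 ≤ 1 / 4096 ∧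
      (2 * (k + (k + 1 : ℕ)) / R ^ 2) ^ (k + 1) ≤ 1 / 4 ∧
      4 * (2 * (k + 2 + (k + 1 : ℕ)) / R ^ 2) ^ (k + 1) * (2 + 8 * ((k : ℝ) + 2) ^ 2) ≤ h / 16 := by
  -- At R² ≥ 32n the tail ratio is at most 3/16. The cube pays for the factor of order n² and for
  -- the lower bound of order 1/n on h.
  have ht := tendsto_pow_const_mul_const_pow_of_abs_lt_one 3 (r := 3 / 16) 
    (abs_lt.2 ⟨by norm_num, by norm_num⟩)
  have hev := (ht.eventually_le_const (by norm_num : (0 : ℝ) < 1 / 1000000)).and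
    (Filter.eventually_ge_atTop 1)
  obtain ⟨n₀, hn₀⟩ := Filter.eventually_atTop.1 hev
  refine ⟨max n₀ 1, le_max_right _ _, fun k hk M hM => ?_⟩
  obtain ⟨hn, -⟩ := hn₀ (k + 1) ((le_max_left _ _).trans hk)
  push_cast at hn
  set n : ℝ := (k : ℝ) + 1 with hndef
  have hk0 : (0 : ℝ) ≤ k := Nat.cast_nonneg k
  have hn1 : 1 ≤ n := by linarith
  have hM' : 1024 * n ≤ M := by rw [hndef]; exact_mod_cast hM
  set h : ℝ := (Real.sqrt (8192 * n))⁻¹ with hh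
  have hpos : 0 < h := inv_pos.2 (Real.sqrt_pos.2 (by positivity))
  have hh2 : h ^ 2 = 1 / (8192 * n) := by
    rw [hh, inv_pow, Real.sq_sqrt (by positivity), one_div]
  have hlow : 1 / (128 * n) ≤ h := by
    rw [hh, ← one_div]
    refine one_div_le_one_div_of_le (Real.sqrt_pos.2 (by positivity)) ?_
    rw [Real.sqrt_le_left (by positivity)]
    nlinarith
  have hMpos : (0 : ℝ) < M := by linarith
  have hR2 : 32 * n ≤ (M * h / 2) ^ 2 := by
    have e : (M * h / 2) ^ 2 = M ^ 2 / (32768 * n) := by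
      rw [div_pow, mul_pow, hh2]; field_simp; norm_num
    rw [e, le_div_iff₀ (by positivity)]
    nlinarith
  refine ⟨h, M * h / 2, hpos, by positivity, by ring, ?_, ?_, ?_⟩
  · rw [hh2, mul_one_div, div_le_iff₀ (by positivity)]
    linarith
  · push_cast
    calc _ ≤ (1 / 4 : ℝ) ^ (k + 1) := by
          refine pow_le_pow_left₀ (by positivity) ?_ _
          rw [div_le_iff₀ (by nlinarith)]
          linarith
      _ ≤ _ := pow_le_of_le_one (by norm_num) (by norm_num) (by omega)
  · push_cast
    have h1 : (2 * (k + 2 + (k + 1)) / (M * h / 2) ^ 2 : ℝ) ≤ 3 / 16 := by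
      rw [div_le_iff₀ (by nlinarith)]
      linarith
    have h2 : (2 * (k + 2 + (k + 1)) / (M * h / 2) ^ 2 : ℝ) ^ (k + 1) ≤ (3 / 16) ^ (k + 1) := by
      gcongr
    have h3 : 2 + 8 * ((k : ℝ) + 2) ^ 2 ≤ 34 * n ^ 2 := by nlinarith
    calc _ ≤ 4 * (3 / 16) ^ (k + 1) * (34 * n ^ 2) := by gcongr
      _ = 136 / n * (n ^ 3 * (3 / 16) ^ (k + 1)) := by field_simp; norm_num
      _ ≤ 136 / n * (1 / 1000000) := by gcongr
      _ ≤ 1 / (128 * n) / 16 := by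
          rw [div_mul_eq_mul_div, div_div, div_le_div_iff₀ (by positivity) (by positivity)]
          nlinarith
      _ ≤ _ := by gcongr

/-- Multiclass linear classifiers on a line admit confusion matrices whose labels match a number
of moments that is linear in the number of classes. -/
theorem exists_cell_isMomentMatching : ∃ c : ℕ, 1 ≤ c ∧ ∀ K : ℕ, 2 ≤ K →
    ∃ n : ℕ, 1 ≤ n ∧ K ≤ c * n ∧ ∃ (F : ℝ → Fin K) (E : Fin K → Fin K → ℝ), Measurable F ∧
      (∀ (d : ℕ) (v : EuclideanSpace ℝ (Fin d)),
        (fun x => F (inner ℝ v x)) ∈ linearClassifiers d K) ∧ IsMomentMatching n F E := by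
  obtain ⟨n₀, hn₀, hpar⟩ := exists_grid_parameters
  -- The factor 1024 is the number of cells per moment. The summand n₀ covers small K, where one
  -- moment must do; the 2 covers the unbounded cells and the rounding in M / 1024.
  refine ⟨1024 * (n₀ + 2), by omega, fun K hK => ?_⟩
  obtain ⟨M, rfl⟩ : ∃ M, K = M + 2 := ⟨K - 2, by omega⟩
  by_cases hbig : n₀ ≤ M / 1024
  · obtain ⟨k, hk⟩ : ∃ k, M / 1024 = k + 1 := ⟨M / 1024 - 1, by omega⟩
    obtain ⟨h, R, hh, hR, h1, h2, h3, h4⟩ := hpar k (by omega) M (by omega)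
    obtain ⟨E, hE⟩ := exists_isMomentMatching_of_leverage (n := k + 1) (by omega)
      (measurable_cell (-R) h (M + 1)) fun p hp i => leverage_cell hh hR h1 h2 h3 h4
        (Nat.lt_succ_iff.1 hp) i
    have hc : M + 2 ≤ 1024 * (n₀ + 2) * (k + 1) :=
      (by omega : M + 2 ≤ 1024 * 3 * (k + 1)).trans (by gcongr; omega)
    refine ⟨k + 1, by omega, hc, cell (-R) h (M + 1), E, measurable_cell _ _ _,
      fun d v => cell_inner_mem_linearClassifiers _ hh.le _ v, hE⟩
  · obtain ⟨E, hE⟩ := exists_isMomentMatching_one (N := M + 1) (by omega)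
    exact ⟨1, le_rfl, by omega, cell 0 1 (M + 1), E, measurable_cell _ _ _,
      fun d v => cell_inner_mem_linearClassifiers _ zero_le_one _ v, hE⟩

/-! ### The hidden direction distributions -/

/-- The uniform distribution on the labels. -/
noncomputable def uniformLabel (K : ℕ) : Measure (Fin K) := (K : ENNReal)⁻¹ • Measure.count

/-- Standard Gaussian points with independent uniform labels. -/
noncomputable def nullDist (d K : ℕ) : Measure (Example d K) :=
  (stdGaussian (EuclideanSpace ℝ (Fin d))).prod (uniformLabel K)

theorem isProbabilityMeasure_uniformLabel {K : ℕ} (hK : K ≠ 0) :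
    IsProbabilityMeasure (uniformLabel K) := by
  constructor
  rw [uniformLabel, Measure.smul_apply, Measure.count_univ]
  simp only [ENat.card_eq_coe_fintype_card, Fintype.card_fin, smul_eq_mul]
  exact ENNReal.inv_mul_cancel (by exact_mod_cast hK) (ENNReal.natCast_ne_top K)

theorem isProbabilityMeasure_nullDist (d : ℕ) {K : ℕ} (hK : K ≠ 0) :
    IsProbabilityMeasure (nullDist d K) := by
  have := isProbabilityMeasure_uniformLabel hK
  unfold nullDist
  infer_instance

theorem integral_nullDist {d K : ℕ} (hK : K ≠ 0) {f : Example d K → ℝ} (hf : Measurable f)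
    {B : ℝ} (hB : ∀ p, |f p| ≤ B) : ∫ p, f p ∂(nullDist d K)
      = ∫ x, (∑ i, f (x, i)) / K ∂(stdGaussian (EuclideanSpace ℝ (Fin d))) := by
  have := isProbabilityMeasure_uniformLabel hK
  have hi : Integrable f (nullDist d K) := by
    have := isProbabilityMeasure_nullDist d hK
    exact Integrable.of_bound hf.aestronglyMeasurable B (Filter.Eventually.of_forall hB)
  rw [nullDist, integral_prod _ hi]
  refine integral_congr_ae (Filter.Eventually.of_forall fun x => ?_)
  simp only [uniformLabel]
  rw [integral_smul_measure, integral_count]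
  simp only [ENNReal.toReal_inv, ENNReal.toReal_natCast, smul_eq_mul]
  rw [inv_mul_eq_div]

/-- The relative perturbation of `nullDist` for the hidden direction `v`. -/
noncomputable def hiddenPert {d K : ℕ} (F : ℝ → Fin K) (E : Fin K → Fin K → ℝ)
    (v : EuclideanSpace ℝ (Fin d)) (p : Example d K) : ℝ :=
  E (F (inner ℝ v p.1)) p.2 / 6

theorem measurable_hiddenPert {d K : ℕ} {F : ℝ → Fin K} (hF : Measurable F)
    (E : Fin K → Fin K → ℝ) (v : EuclideanSpace ℝ (Fin d)) : Measurable (hiddenPert F E v) := by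
  have h1 : Measurable fun p : Fin K × Fin K => E p.1 p.2 / 6 := Measurable.of_discrete
  have h2 : Measurable fun p : Example d K => (F (inner ℝ v p.1), p.2) := by fun_prop
  exact h1.comp h2

section

variable {d K n : ℕ} {F : ℝ → Fin K} {E : Fin K → Fin K → ℝ}

/-- The divisor 6 turns the entry bound 3 into the 1/2 required for tilting. -/
theorem IsMomentMatching.abs_hiddenPert_le (hE : IsMomentMatching n F E)
    (v : EuclideanSpace ℝ (Fin d)) (p : Example d K) : |hiddenPert F E v p| ≤ 1 / 2 := by
  rw [hiddenPert, abs_div, abs_of_pos (by norm_num : (0 : ℝ) < 6)]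
  linarith [hE.entry_le (F (inner ℝ v p.1)) p.2]

theorem IsMomentMatching.integral_hiddenPert (hE : IsMomentMatching n F E) (hK : K ≠ 0)
    (hF : Measurable F) (v : EuclideanSpace ℝ (Fin d)) :
    ∫ p, hiddenPert F E v p ∂(nullDist d K) = 0 := by
  rw [integral_nullDist hK (measurable_hiddenPert hF E v) (hE.abs_hiddenPert_le v)]
  simp only [hiddenPert]
  simp only [← Finset.sum_div, hE.row_sum, zero_div, integral_zero]

/-- For each fixed label the correlation estimate applies with B = 3, and averaging over labels
keeps the bound; 2·3²/36 = 1/2 absorbs the constant. -/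
theorem IsMomentMatching.integral_hiddenPert_mul_le (hE : IsMomentMatching n F E) (hK : K ≠ 0)
    (hF : Measurable F) {v w : EuclideanSpace ℝ (Fin d)} (hv : ‖v‖ = 1) (hw : ‖w‖ = 1) {r : ℝ}
    (hr : 0 < r) (hr8 : r ≤ 1 / 8) (hvw : |inner ℝ v w| ≤ r) :
    ∫ p, hiddenPert F E v p * hiddenPert F E w p ∂(nullDist d K)
      ≤ (∫ x, Real.exp (x ^ 2 / 4) ∂(gaussianReal 0 1)) ^ 2 * (4 * r) ^ n := by
  set G := ∫ x, Real.exp (x ^ 2 / 4) ∂(gaussianReal 0 1)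
  have hφ : ∀ i, Measurable fun z => E (F z) i := fun i =>
    (Measurable.of_discrete (f := fun j : Fin K => E j i)).comp hF
  have hKpos : (0 : ℝ) < K := by exact_mod_cast Nat.pos_of_ne_zero hK
  rw [integral_nullDist hK (f := fun p => hiddenPert F E v p * hiddenPert F E w p)
    ((measurable_hiddenPert hF E v).mul (measurable_hiddenPert hF E w))
    (B := 1 / 2 * (1 / 2)) fun p => by
      rw [abs_mul]
      exact mul_le_mul (hE.abs_hiddenPert_le v p) (hE.abs_hiddenPert_le w p) (abs_nonneg _)
        (by norm_num)]
  simp only [hiddenPert]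
  rw [integral_div, integral_finsetSum]
  · rw [div_le_iff₀ hKpos]
    calc _ ≤ ∑ i : Fin K, G ^ 2 * (4 * r) ^ n := by
          refine Finset.sum_le_sum fun i _ => ?_
          have h := (le_abs_self _).trans (abs_integral_mul_inner_inner_le hv hw hr hr8 hvw (hφ i)
            (fun z => hE.entry_le (F z) i) (fun t ht => hE.moment t ht i))
          have e : ∀ x, E (F (inner ℝ v x)) i / 6 * (E (F (inner ℝ w x)) i / 6)
              = (E (F (inner ℝ v x)) i * E (F (inner ℝ w x)) i) / 36 := fun x => by ring
          simp_rw [e]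
          rw [integral_div]
          have : 0 ≤ G ^ 2 * (4 * r) ^ n := by positivity
          linarith
      _ = _ := by simp; ring
  · intro i _
    refine Integrable.of_bound (C := 1 / 4) ?_ (Filter.Eventually.of_forall fun x => ?_)
    · have h1 : Measurable fun x => E (F (inner ℝ v x)) i := (hφ i).comp (by fun_prop)
      have h2 : Measurable fun x => E (F (inner ℝ w x)) i := (hφ i).comp (by fun_prop)
      exact ((h1.div_const 6).mul (h2.div_const 6)).aestronglyMeasurable
    · rw [norm_mul, Real.norm_eq_abs, Real.norm_eq_abs]
      have h1 := hE.abs_hiddenPert_le v (x, i)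
      have h2 := hE.abs_hiddenPert_le w (x, i)
      simp only [hiddenPert] at h1 h2
      nlinarith [abs_nonneg (E (F (inner ℝ v x)) i / 6), abs_nonneg (E (F (inner ℝ w x)) i / 6)]

/-- The distribution of labelled examples with hidden direction `v`. -/
noncomputable def hiddenDist {d K : ℕ} (F : ℝ → Fin K) (E : Fin K → Fin K → ℝ)
    (v : EuclideanSpace ℝ (Fin d)) : Measure (Example d K) :=
  tilt (nullDist d K) (hiddenPert F E v)

theorem IsMomentMatching.isProbabilityMeasure_hiddenDist (hE : IsMomentMatching n F E)
    (hK : K ≠ 0) (hF : Measurable F) (v : EuclideanSpace ℝ (Fin d)) :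
    IsProbabilityMeasure (hiddenDist F E v) := by
  have := isProbabilityMeasure_nullDist d hK
  exact isProbabilityMeasure_tilt (measurable_hiddenPert hF E v) (hE.abs_hiddenPert_le v)
    (hE.integral_hiddenPert hK hF v)

/-- The confusion matrix that belongs to the perturbation `E`. -/
noncomputable def confusion {K : ℕ} (E : Fin K → Fin K → ℝ) : Matrix (Fin K) (Fin K) ℝ :=
  fun i j => (1 + E i j / 6) / K

theorem IsMomentMatching.confusion_mem (hE : IsMomentMatching n F E) (hK : K ≠ 0) :
    confusion E ∈ Matrix.rowStochastic ℝ (Fin K) := by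
  have hK' : (K : ℝ) ≠ 0 := by exact_mod_cast hK
  rw [Matrix.mem_rowStochastic_iff_sum]
  refine ⟨fun i j => ?_, fun i => ?_⟩
  · have := abs_le.1 (hE.entry_le i j)
    exact div_nonneg (by linarith) (Nat.cast_nonneg K)
  · simp only [confusion]
    rw [← Finset.sum_div, Finset.sum_add_distrib, ← Finset.sum_div, hE.row_sum]
    simp [hK']

theorem IsMomentMatching.hiddenDist_prod_singleton (hE : IsMomentMatching n F E) (hK : K ≠ 0)
    (v : EuclideanSpace ℝ (Fin d)) (i : Fin K)
    {A : Set (EuclideanSpace ℝ (Fin d))} (hA : MeasurableSet A) (hF : Measurable F) :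
    hiddenDist F E v (A ×ˢ {i}) = ∫⁻ x in A, ENNReal.ofReal (confusion E (F (inner ℝ v x)) i)
      ∂(stdGaussian (EuclideanSpace ℝ (Fin d))) := by
  have := isProbabilityMeasure_uniformLabel hK
  have hKpos : (0 : ℝ) < K := by exact_mod_cast Nat.pos_of_ne_zero hK
  have hm : Measurable fun p => ENNReal.ofReal (1 + hiddenPert F E v p) :=
    ((measurable_hiddenPert hF E v).const_add 1).ennreal_ofReal
  rw [hiddenDist, tilt, withDensity_apply _ (hA.prod (measurableSet_singleton i)), nullDist,
    ← Measure.prod_restrict, lintegral_prod _ hm.aemeasurable]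
  refine lintegral_congr fun x => ?_
  rw [lintegral_singleton, uniformLabel, Measure.smul_apply, Measure.count_singleton,
    smul_eq_mul, mul_one, ← ENNReal.ofReal_natCast, ← ENNReal.ofReal_inv_of_pos hKpos,
    ← ENNReal.ofReal_mul]
  · rfl
  · have := abs_le.1 (hE.abs_hiddenPert_le v (x, i))
    linarith

theorem IsMomentMatching.fst_hiddenDist (hE : IsMomentMatching n F E) (hK : K ≠ 0)
    (hF : Measurable F) (v : EuclideanSpace ℝ (Fin d)) :
    (hiddenDist F E v).fst = stdGaussian (EuclideanSpace ℝ (Fin d)) := by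
  ext A hA
  have hφ : ∀ i, Measurable fun x : EuclideanSpace ℝ (Fin d) => confusion E (F (inner ℝ v x)) i :=
    fun i => (Measurable.of_discrete (f := fun j : Fin K => confusion E j i)).comp
      (hF.comp (by fun_prop))
  have hnn := (Matrix.mem_rowStochastic_iff_sum.1 (hE.confusion_mem hK)).1
  have hsum := (Matrix.mem_rowStochastic_iff_sum.1 (hE.confusion_mem hK)).2
  have e : Prod.fst ⁻¹' A = ⋃ i : Fin K, A ×ˢ {i} := by
    ext p
    simp
  rw [Measure.fst_apply hA, e, measure_iUnion]
  · rw [tsum_fintype]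
    simp_rw [hE.hiddenDist_prod_singleton hK v _ hA hF]
    rw [← lintegral_finsetSum _ fun i _ => (hφ i).ennreal_ofReal]
    calc _ = ∫⁻ x in A, 1 ∂(stdGaussian (EuclideanSpace ℝ (Fin d))) := by
          refine lintegral_congr fun x => ?_
          rw [← ENNReal.ofReal_sum_of_nonneg fun i _ => hnn _ _, hsum, ENNReal.ofReal_one]
      _ = _ := by simp
  · intro i j hij
    exact Set.disjoint_left.2 fun p hp hq => hij (hp.2.symm.trans hq.2)
  · exact fun i => hA.prod (measurableSet_singleton i)

/-- A diagonal advantage of 1/2 in E becomes 1/(12K) in the confusion matrix. -/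
theorem IsMomentMatching.isInput_hiddenDist (hE : IsMomentMatching n F E) (hK : K ≠ 0)
    (hF : Measurable F) {v : EuclideanSpace ℝ (Fin d)}
    (hlin : (fun x => F (inner ℝ v x)) ∈ linearClassifiers d K) {γ : ℝ} (hγ : γ < 1 / (12 * K)) :
    IsInput d K γ (hiddenDist F E v) := by
  have hKpos : (0 : ℝ) < K := by exact_mod_cast Nat.pos_of_ne_zero hK
  refine ⟨hE.isProbabilityMeasure_hiddenDist hK hF v, hE.fst_hiddenDist hK hF v, _, hlin,
    confusion E, hE.confusion_mem hK, fun i j hij => ?_, fun i A hA => ?_⟩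
  · have h1 := hE.diag i j hij
    have h2 : confusion E i i - confusion E i j = (E i i - E i j) / (6 * K) := by
      simp only [confusion]
      field_simp
      ring
    have h3 : 1 / (12 * (K : ℝ)) ≤ (E i i - E i j) / (6 * K) := by
      rw [div_le_div_iff₀ (by positivity) (by positivity)]
      nlinarith
    linarith
  · rw [hE.fst_hiddenDist hK hF v]
    exact hE.hiddenDist_prod_singleton hK v i hA hF

/-! ### Errors of hypotheses -/

/-- The indicator function of a correct prediction. -/
noncomputable def hit {X : Type*} {K : ℕ} (h : X → Fin K) (p : X × Fin K) : ℝ :=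
  if h p.1 = p.2 then 1 else 0

theorem abs_hit_le {X : Type*} {K : ℕ} (h : X → Fin K) (p : X × Fin K) : |hit h p| ≤ 1 := by
  unfold hit
  split_ifs <;> simp

theorem measurableSet_hit {X : Type*} [MeasurableSpace X] {K : ℕ} {h : X → Fin K}
    (hh : Measurable h) : MeasurableSet {p : X × Fin K | h p.1 = p.2} :=
  measurableSet_eq_fun (hh.comp measurable_fst) measurable_snd

theorem measurable_hit {X : Type*} [MeasurableSpace X] {K : ℕ} {h : X → Fin K}
    (hh : Measurable h) : Measurable (hit h) :=
  Measurable.ite (measurableSet_hit hh) measurable_const measurable_const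

theorem err_eq {X : Type*} [MeasurableSpace X] {K : ℕ} {h : X → Fin K} (hh : Measurable h)
    (D : Measure (X × Fin K)) [IsProbabilityMeasure D] :
    err D h = ENNReal.ofReal (1 - ∫ p, hit h p ∂D) := by
  have h1 : {p : X × Fin K | h p.1 ≠ p.2} = {p : X × Fin K | h p.1 = p.2}ᶜ := rfl
  have h2 : hit h = ({p : X × Fin K | h p.1 = p.2}).indicator 1 := by
    funext p
    simp [hit, Set.indicator_apply]
  rw [err, h1, h2, integral_indicator_one (measurableSet_hit hh),
    ← probReal_compl_eq_one_sub (measurableSet_hit hh), ofReal_measureReal]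

/-- Every hypothesis is correct with probability 1/K under uniform labels; any advantage is its
correlation with the perturbation. -/
theorem IsMomentMatching.integral_hit_hiddenDist (hE : IsMomentMatching n F E) (hK : K ≠ 0)
    (hF : Measurable F) (v : EuclideanSpace ℝ (Fin d)) {h : EuclideanSpace ℝ (Fin d) → Fin K}
    (hh : Measurable h) : ∫ p, hit h p ∂(hiddenDist F E v)
      = 1 / K + ∫ p, hit h p * hiddenPert F E v p ∂(nullDist d K) := by
  have := isProbabilityMeasure_nullDist d hK
  have hq := measurable_hit hh
  have hg := measurable_hiddenPert hF E v
  have hqL := memLp_two_of_bound (μ := nullDist d K) hq (abs_hit_le h)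
  have hgL := memLp_two_of_bound (μ := nullDist d K) hg (hE.abs_hiddenPert_le v)
  rw [hiddenDist, integral_tilt hg (hE.abs_hiddenPert_le v)]
  have e : (fun p => (1 + hiddenPert F E v p) * hit h p)
      = fun p => hit h p + hit h p * hiddenPert F E v p := by funext p; ring
  rw [e, integral_add (hqL.integrable one_le_two) (integrable_mul_of_memLp_two hqL hgL),
    integral_nullDist hK hq (abs_hit_le h)]
  simp [hit]

theorem IsMomentMatching.gap_le_integral_hit (hE : IsMomentMatching n F E) (hK : K ≠ 0)
    (hF : Measurable F) {v : EuclideanSpace ℝ (Fin d)} (hv : ‖v‖ = 1) :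
    1 / (48 * (K : ℝ)) ≤ ∫ p, hit (fun x => F (inner ℝ v x)) p * hiddenPert F E v p
      ∂(nullDist d K) := by
  have hKpos : (0 : ℝ) < K := by exact_mod_cast Nat.pos_of_ne_zero hK
  have hh : Measurable fun x : EuclideanSpace ℝ (Fin d) => F (inner ℝ v x) :=
    hF.comp (by fun_prop)
  have hφ : Measurable fun z => E (F z) (F z) :=
    (Measurable.of_discrete (f := fun j : Fin K => E j j)).comp hF
  rw [integral_nullDist hK
    (f := fun p => hit (fun x => F (inner ℝ v x)) p * hiddenPert F E v p)
    ((measurable_hit hh).mul (measurable_hiddenPert hF E v))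
    (B := 1 * (1 / 2)) fun p => by
      rw [abs_mul]
      exact mul_le_mul (abs_hit_le _ p) (hE.abs_hiddenPert_le v p) (abs_nonneg _) (by norm_num)]
  simp only [hit, hiddenPert, ite_mul, one_mul, zero_mul, Finset.sum_ite_eq,
    Finset.mem_univ, if_true]
  rw [integral_div, integral_div]
  have h1 : ∫ x, E (F (inner ℝ v x)) (F (inner ℝ v x)) ∂(stdGaussian (EuclideanSpace ℝ (Fin d)))
      = ∫ z, E (F z) (F z) ∂(gaussianReal 0 1) := by
    rw [← map_inner_stdGaussian hv, integral_map (by fun_prop) hφ.aestronglyMeasurable]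
  rw [h1, div_div, div_le_div_iff₀ (by positivity) (by positivity)]
  nlinarith [hE.gap]

/-- A hypothesis that is almost optimal for the hidden direction `v` correlates with the
perturbation in direction `v`. -/
theorem IsMomentMatching.correlation_of_err_le (hE : IsMomentMatching n F E) (hK : K ≠ 0)
    (hF : Measurable F) {v : EuclideanSpace ℝ (Fin d)} (hv : ‖v‖ = 1)
    (hlin : (fun x => F (inner ℝ v x)) ∈ linearClassifiers d K) {ε : ℝ} (hε0 : 0 ≤ ε)
    (hε : ε ≤ 1 / (96 * K)) {h : EuclideanSpace ℝ (Fin d) → Fin K} (hh : Measurable h)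
    (herr : err (hiddenDist F E v) h
      ≤ opt (linearClassifiers d K) (hiddenDist F E v) + ENNReal.ofReal ε) :
    1 / (96 * (K : ℝ)) ≤ ∫ p, hit h p * hiddenPert F E v p ∂(nullDist d K) := by
  have hprob := hE.isProbabilityMeasure_hiddenDist hK hF v
  have hfm : Measurable fun x : EuclideanSpace ℝ (Fin d) => F (inner ℝ v x) :=
    hF.comp (by fun_prop)
  -- Bounding OPT by the error of the hidden classifier suffices; its optimality is not needed.
  have h1 : opt (linearClassifiers d K) (hiddenDist F E v)
      ≤ err (hiddenDist F E v) fun x => F (inner ℝ v x) := iInf₂_le _ hlin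
  have h2 := herr.trans (add_le_add h1 le_rfl)
  have hle : ∀ g : EuclideanSpace ℝ (Fin d) → Fin K, Measurable g →
      0 ≤ 1 - ∫ p, hit g p ∂(hiddenDist F E v) := by
    intro g hg
    have := (le_abs_self _).trans (norm_integral_le_of_norm_le_const (μ := hiddenDist F E v)
      (f := hit g) (C := 1) (Filter.Eventually.of_forall (abs_hit_le g)))
    rw [probReal_univ, mul_one] at this
    linarith
  rw [err_eq hh, err_eq hfm, ← ENNReal.ofReal_add (hle _ hfm) hε0,
    ENNReal.ofReal_le_ofReal_iff (add_nonneg (hle _ hfm) hε0),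
    hE.integral_hit_hiddenDist hK hF v hh, hE.integral_hit_hiddenDist hK hF v hfm] at h2
  have h3 := hE.gap_le_integral_hit hK hF hv
  have h4 : 1 / (48 * (K : ℝ)) = 1 / (96 * K) + 1 / (96 * K) := by
    have hKpos : (K : ℝ) ≠ 0 := by exact_mod_cast hK
    field_simp
    norm_num
  linarith

/-- No hypothesis is almost optimal for many almost orthogonal hidden directions. -/
theorem card_le_of_correlation {X ι : Type*} [MeasurableSpace X] {μ : Measure X}
    [IsProbabilityMeasure μ] {g : ι → X → ℝ} (hg : ∀ i, Measurable (g i))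
    (hb : ∀ i x, |g i x| ≤ 1 / 2) {τ t : ℝ} (hτ : 0 ≤ τ)
    (hoff : ∀ i j, i ≠ j → ∫ x, g i x * g j x ∂μ ≤ τ) (ht : 0 < t) (hτt : 2 * τ ≤ t ^ 2)
    {q : X → ℝ} (hq : Measurable q) (hq1 : ∀ x, |q x| ≤ 1) (S : Finset ι)
    (hS : ∀ i ∈ S, t ≤ ∫ x, q x * g i x ∂μ) : (S.card : ℝ) ≤ 1 / (2 * t ^ 2) := by
  have hdiag : ∀ i, ∫ x, g i x ^ 2 ∂μ ≤ 1 / 4 := fun i =>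
    (integral_sq_le_sq (hg i) (hb i)).trans (by norm_num)
  have hW : ∫ x, q x ^ 2 ∂μ ≤ 1 := (integral_sq_le_sq hq hq1).trans (by norm_num)
  have h := card_mul_le_of_correlated (fun i => memLp_two_of_bound (hg i) (hb i)) (by norm_num)
    hdiag hτ hoff (memLp_two_of_bound hq hq1) ht.le S hS
  have hn : (0 : ℝ) ≤ S.card := Nat.cast_nonneg _
  have h1 : (∫ x, q x ^ 2 ∂μ) * τ ≤ t ^ 2 / 2 := by nlinarith
  have h2 : (S.card : ℝ) * (t ^ 2 / 2) ≤ 1 / 4 := by nlinarith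
  rw [le_div_iff₀ (by positivity)]
  linarith

end

/-! ### The lower bound -/

/-- The adversarial oracle: it gives the answer for μ, which says nothing about D, whenever that is
within tolerance. -/
theorem isVSTAT_ite {X : Type*} [MeasurableSpace X] (μ D : Measure X) :
    IsVSTAT (fun q => if |∫ x, q.fn x ∂μ - ∫ x, q.fn x ∂D| ≤ q.tolerance D
      then ∫ x, q.fn x ∂μ else ∫ x, q.fn x ∂D) D := by
  intro q
  dsimp only
  split_ifs with h
  · exact h
  · rw [sub_self, abs_zero]
    exact le_trans (by have := q.u_pos; positivity) (le_max_left (1 / q.u) _)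

/-- If every valid oracle almost surely kept the run within budget, one seed would stay within
budget for all m directions and fail on at most m/3. Separated oracles account for at most 2BU more,
and the common output serves at most 4608K². These cannot add up to m. -/
theorem exists_hard_input {d K n m : ℕ} (hK : K ≠ 0) {F : ℝ → Fin K} {E : Fin K → Fin K → ℝ}
    (hF : Measurable F) (hE : IsMomentMatching n F E)
    (hlin : ∀ v : EuclideanSpace ℝ (Fin d), (fun x => F (inner ℝ v x)) ∈ linearClassifiers d K)
    {v : Fin m → EuclideanSpace ℝ (Fin d)} (hv : ∀ i, ‖v i‖ = 1) {r : ℝ} (hr : 0 < r)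
    (hr8 : r ≤ 1 / 8) (hvr : ∀ i j, i ≠ j → |inner ℝ (v i) (v j)| ≤ r) {τ : ℝ}
    (hτ : (∫ x, Real.exp (x ^ 2 / 4) ∂(gaussianReal 0 1)) ^ 2 * (4 * r) ^ n ≤ τ)
    {U B : ℝ} (hU : 0 < U) (hB : 0 ≤ B) (hUτ : 4 * U * τ ≤ 1)
    (hKτ : 2 * τ ≤ (1 / (96 * (K : ℝ))) ^ 2) (hm : 3 * (B * U) + 6912 * (K : ℝ) ^ 2 < m)
    {γ ε : ℝ} (hγ : γ < 1 / (12 * K)) (hε0 : 0 ≤ ε) (hε : ε ≤ 1 / (96 * K))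
    {Ω : Type*} [MeasurableSpace Ω] (P : Measure Ω) [IsProbabilityMeasure P]
    (A : Ω → SQAlg (Example d K) (Hypothesis d K)) (hA : Learns P d K γ ε A) :
    ∃ D : Measure (Example d K), IsInput d K γ D ∧ ∃ O : Query (Example d K) → ℝ, IsVSTAT O D ∧
      0 < P {ω | B ≤ (((A ω).queries O).length : ℝ) ∨ ∃ q ∈ (A ω).queries O, U ≤ q.u} := by
  classical
  by_contra hcon
  have hprob := isProbabilityMeasure_nullDist d hK
  have hτ0 : 0 ≤ τ := le_trans (by positivity) hτ
  have hKpos : (0 : ℝ) < K := by exact_mod_cast Nat.pos_of_ne_zero hK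
  set μ := nullDist d K
  set g : Fin m → Example d K → ℝ := fun i => hiddenPert F E (v i)
  set D : Fin m → Measure (Example d K) := fun i => hiddenDist F E (v i) with hD
  have hg : ∀ i, Measurable (g i) := fun i => measurable_hiddenPert hF E (v i)
  have hb : ∀ i x, |g i x| ≤ 1 / 2 := fun i => hE.abs_hiddenPert_le (v i)
  have h0 : ∀ i, ∫ x, g i x ∂μ = 0 := fun i => hE.integral_hiddenPert hK hF (v i)
  have hoff : ∀ i j, i ≠ j → ∫ x, g i x * g j x ∂μ ≤ τ := fun i j hij =>
    (hE.integral_hiddenPert_mul_le hK hF (hv i) (hv j) hr hr8 (hvr i j hij)).trans hτ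
  have hin : ∀ i, IsInput d K γ (D i) := fun i => hE.isInput_hiddenDist hK hF (hlin (v i)) hγ
  set O₀ : Query (Example d K) → ℝ := fun q => ∫ x, q.fn x ∂μ with hO₀
  set O : Fin m → Query (Example d K) → ℝ := fun i q =>
    if |∫ x, q.fn x ∂μ - ∫ x, q.fn x ∂(D i)| ≤ q.tolerance (D i)
      then ∫ x, q.fn x ∂μ else ∫ x, q.fn x ∂(D i) with hO
  have hvalid : ∀ i, IsVSTAT (O i) (D i) := fun i => isVSTAT_ite μ (D i)
  have hfew : ∀ q : Query (Example d K), q.u < U →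
      ∃ S : Finset (Fin m), S.card ≤ ⌊2 * U⌋₊ ∧ ∀ i ∉ S, O i q = O₀ q := by
    intro q hq
    refine ⟨Finset.univ.filter fun i =>
      q.tolerance (D i) < |∫ x, q.fn x ∂μ - ∫ x, q.fn x ∂(D i)|, ?_, ?_⟩
    · refine Nat.le_floor ((card_distinguished_le hg hb h0 hτ0 hoff q ?_ _
        fun i hi => (Finset.mem_filter.1 hi).2).trans (by linarith))
      exact le_trans (by gcongr) hUτ
    · intro i hi
      simp only [Finset.mem_filter, Finset.mem_univ, true_and, not_lt] at hi
      simp only [hO, hO₀, if_pos hi]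
  obtain ⟨ω, hω, S₁, hS₁, hgood⟩ := exists_few_failures P
    (fun i => {ω | ¬ err (D i) ((A ω).result (O i)).1 ≤
        opt (linearClassifiers d K) (D i) + ENNReal.ofReal ε})
    (fun i => {ω | B ≤ (((A ω).queries (O i)).length : ℝ) ∨
      ∃ q ∈ (A ω).queries (O i), U ≤ q.u})
    (fun i => hA (D i) (hin i) (O i) (hvalid i)) (fun i => by
      by_contra hne
      exact hcon ⟨D i, hin i, O i, hvalid i, pos_iff_ne_zero.2 hne⟩)
  -- The seed is now fixed, so the algorithm is a deterministic decision tree.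
  obtain ⟨y, S₂, hS₂, hres⟩ := exists_common_result O₀ O U ⌊2 * U⌋₊ hfew ⌊B⌋₊ (A ω)
    ⟨(A ω).result O₀⟩
  set S : Finset (Fin m) := (S₁ ∪ S₂)ᶜ with hS
  have hcorr : ∀ i ∈ S, 1 / (96 * (K : ℝ)) ≤ ∫ x, hit y.1 x * g i x ∂μ := by
    intro i hi
    rw [hS, Finset.mem_compl, Finset.mem_union, not_or] at hi
    have h1 := hω i
    simp only [Set.mem_ofPred_eq, not_or, not_le, not_exists, not_and] at h1
    have h2 := hgood i hi.1
    simp only [Set.mem_ofPred_eq, not_not] at h2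
    rw [hres i hi.2 (Nat.le_floor h1.1.le) h1.2] at h2
    exact hE.correlation_of_err_le hK hF (hv i) (hlin (v i)) hε0 hε y.2 h2
  have hcard := card_le_of_correlation hg hb hτ0 hoff (by positivity) hKτ
    (measurable_hit y.2) (abs_hit_le y.1) S hcorr
  have e : 1 / (2 * (1 / (96 * (K : ℝ))) ^ 2) = 4608 * (K : ℝ) ^ 2 := by
    field_simp
    norm_num
  rw [e] at hcard
  have h5 : (m : ℝ) ≤ S.card + (S₁.card + S₂.card) := by
    have h6 := Finset.card_compl_add_card (S₁ ∪ S₂)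
    rw [Fintype.card_fin, ← hS] at h6
    have h7 := Finset.card_union_le S₁ S₂
    exact_mod_cast (by omega : m ≤ S.card + (S₁.card + S₂.card))
  have h8 : (S₂.card : ℝ) ≤ 2 * (B * U) := by
    calc (S₂.card : ℝ) ≤ (⌊B⌋₊ : ℝ) * ⌊2 * U⌋₊ := by exact_mod_cast hS₂
      _ ≤ B * (2 * U) := mul_le_mul (Nat.floor_le hB) (Nat.floor_le (by positivity))
          (Nat.cast_nonneg _) hB
      _ = _ := by ring
  rw [Fintype.card_fin] at hS₁
  linarith

theorem eventually_log_rpow_bounds {c s κ : ℝ} (hc : 0 < c) (hs : 0 < s) (hκ : 0 < κ) (Q : ℝ) :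
    ∃ d₀ : ℕ, ∀ d : ℕ, d₀ ≤ d → 1 ≤ d ∧ Q ≤ (d : ℝ) ^ c ∧ 8 ≤ (d : ℝ) ^ s ∧
      2 * (16 + Real.log d) ≤ (d : ℝ) ^ κ := by
  have hnat := tendsto_natCast_atTop_atTop (R := ℝ)
  have h1 := ((tendsto_rpow_atTop hc).comp hnat).eventually_ge_atTop Q
  have h2 := ((tendsto_rpow_atTop hs).comp hnat).eventually_ge_atTop 8
  have h3 := ((tendsto_rpow_atTop hκ).comp hnat).eventually_ge_atTop 64
  have h4 := hnat.eventually ((isLittleO_log_rpow_atTop hκ).bound (by norm_num : (0 : ℝ) < 1 / 4))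
  obtain ⟨d₀, hd₀⟩ := Filter.eventually_atTop.1
    ((((h1.and h2).and h3).and h4).and (Filter.eventually_ge_atTop 1))
  refine ⟨d₀, fun d hd => ?_⟩
  obtain ⟨⟨⟨⟨h1, h2⟩, h3⟩, h4⟩, h5⟩ := hd₀ d hd
  refine ⟨h5, h1, h2, ?_⟩
  simp only [Function.comp_apply] at h3
  rw [Real.norm_eq_abs, Real.norm_of_nonneg (by positivity)] at h4
  have := (le_abs_self _).trans h4
  linarith

/-- Applied with y = d^(1-δ), l = log d and t = d^(δ/2): B is at most e^y, V and K² are at most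
e^(yl), and m is of order e^(yt/2). The number 13830 is 2(3 + 6912). -/
theorem budget_lt_card {y l t V B K m : ℝ} (hy : 2 ≤ y) (ht : 2 * (16 + l) ≤ t)
    (hV0 : 0 ≤ V) (hV : V ≤ Real.exp (y * l)) (hK : K ^ 2 ≤ V) (hB : B ≤ Real.exp y)
    (hm : Real.exp (y * t / 2) / 2 ≤ m) : 3 * (B * V) + 6912 * K ^ 2 < m := by
  have hbig : 13830 < Real.exp (7 * y) := by
    have h1 : (2 : ℝ) ≤ Real.exp 1 := by linarith [Real.add_one_le_exp 1]
    calc (13830 : ℝ) < 2 ^ 14 := by norm_num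
      _ ≤ Real.exp 1 ^ 14 := pow_le_pow_left₀ two_pos.le h1 _
      _ = Real.exp 14 := by rw [← Real.exp_nat_mul]; norm_num
      _ ≤ _ := Real.exp_le_exp.2 (by linarith)
  have hBV : B * V ≤ Real.exp (y + y * l) := by
    rw [Real.exp_add]
    exact mul_le_mul hB hV hV0 (Real.exp_pos _).le
  have hKV : K ^ 2 ≤ Real.exp (y + y * l) :=
    hK.trans (hV.trans (Real.exp_le_exp.2 (by linarith)))
  have hfinal : Real.exp (y + y * l) * Real.exp (7 * y) ≤ Real.exp (y * t / 2) := by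
    rw [← Real.exp_add]
    refine Real.exp_le_exp.2 ?_
    nlinarith [mul_le_mul_of_nonneg_left ht (by linarith : 0 ≤ y)]
  have h := mul_lt_mul_of_pos_left hbig (Real.exp_pos (y + y * l))
  linarith

theorem mul_lt_pow_eight {x : ℝ} (hx : 2 ≤ x) : 96 * x < x ^ 8 := by
  have : (2 : ℝ) ^ 7 ≤ x ^ 7 := pow_le_pow_left₀ two_pos.le hx _
  rw [pow_succ]
  nlinarith

theorem two_mul_div_pow_four_le {V G K : ℝ} (hV : 4 + 18432 * G ^ 2 ≤ V) (hK : 0 < K)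
    (hKV : K ^ 2 ≤ V) : 4 * V * (G ^ 2 * (V ^ 4)⁻¹) ≤ 1 ∧
      2 * (G ^ 2 * (V ^ 4)⁻¹) ≤ (1 / (96 * K)) ^ 2 := by
  have hG := sq_nonneg G
  have hV1 : 1 ≤ V := by linarith
  have h2 : V ^ 2 ≤ V ^ 4 := pow_le_pow_right₀ hV1 (by norm_num)
  constructor
  · rw [← mul_assoc, ← div_eq_mul_inv, div_le_one (by positivity)]
    nlinarith
  · rw [div_pow, one_pow, ← mul_assoc, ← div_eq_mul_inv, div_le_div_iff₀ (by positivity)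
      (by positivity)]
    have h1 : 18432 * G ^ 2 * K ^ 2 ≤ V * V :=
      mul_le_mul (by linarith) hKV (sq_nonneg K) (by linarith)
    linarith

end SQRCN

theorem theorem5p3 :
    ∃ C : ℕ, ∀ δ : ℝ, 0 < δ → δ < 1 →
      ∃ a : ℝ, 0 < a ∧ ∃ c : ℝ, 0 < c ∧ ∃ d₀ : ℕ,
        ∀ d K : ℕ, d₀ ≤ d → 2 ≤ K → (K : ℝ) ≤ (d : ℝ) ^ (1 - δ) →
        ∀ γ ε : ℝ, 0 < γ → γ ≤ 1 / (K : ℝ) ^ C → 0 < ε → ε ≤ 1 / (K : ℝ) ^ C →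
        ∀ (Ω : Type*) [MeasurableSpace Ω] (P : Measure Ω) [IsProbabilityMeasure P]
          (A : Ω → SQRCN.SQAlg (SQRCN.Example d K) (SQRCN.Hypothesis d K)),
          SQRCN.Learns P d K γ ε A →
          ∃ D : Measure (SQRCN.Example d K), SQRCN.IsInput d K γ D ∧
            ∃ O : SQRCN.Query (SQRCN.Example d K) → ℝ, SQRCN.IsVSTAT O D ∧
              0 < P {ω | (2 : ℝ) ^ ((d : ℝ) ^ a) ≤ (((A ω).queries O).length : ℝ) ∨
                ∃ q ∈ (A ω).queries O, (d : ℝ) ^ (c * (K : ℝ)) ≤ q.u} := by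
  obtain ⟨c₀, hc₀, hgadget⟩ := SQRCN.exists_cell_isMomentMatching
  set G := ∫ x, Real.exp (x ^ 2 / 4) ∂(gaussianReal 0 1) with hG
  -- C = 8 because x⁸ > 96x for x ≥ 2, which brings γ below 1/(12K) and ε below 1/(96K).
  refine ⟨8, fun δ hδ hδ1 => ?_⟩
  have hc₀' : (1 : ℝ) ≤ c₀ := by exact_mod_cast hc₀
  set s : ℝ := δ / 4 with hs
  have hs0 : 0 < s := by positivity
  -- Chosen so that (4r)^n ≤ d^(-sn/2) ≤ d^(-4cK) = V⁻⁴, using K ≤ c₀ n.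
  set c : ℝ := s / (8 * c₀) with hc
  have hcpos : 0 < c := by positivity
  have hc1 : c ≤ 1 := by
    rw [hc, div_le_one (by positivity)]
    linarith
  obtain ⟨d₀, hd₀⟩ := SQRCN.eventually_log_rpow_bounds hcpos (half_pos hs0) (half_pos hδ)
    (4 + 18432 * G ^ 2)
  -- The exponent a = 1 − δ is below the exponent 1 − δ/2 of d r², so the number of directions
  -- exceeds the budget; K ≤ d^(1-δ) keeps V = d^(cK) within exp(d^(1-δ) log d).
  refine ⟨1 - δ, by linarith, c, hcpos, d₀, ?_⟩
  intro d K hd hK hKd γ ε hγ0 hγ hε0 hε Ω _ P _ A hA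
  obtain ⟨hd1, hQ, h8, hlog⟩ := hd₀ d hd
  obtain ⟨n, hn, hKn, F, E, hF, hlin, hE⟩ := hgadget K hK
  have hdpos : (0 : ℝ) < d := by exact_mod_cast hd1
  have hd1' : (1 : ℝ) ≤ d := by exact_mod_cast hd1
  have hK2 : (2 : ℝ) ≤ K := by exact_mod_cast hK
  have hKpos : (0 : ℝ) < K := by linarith
  have hG2 : 0 ≤ G ^ 2 := sq_nonneg G
  set r : ℝ := (d : ℝ) ^ (-s) with hr
  have hrpos : 0 < r := Real.rpow_pos_of_pos hdpos _
  have hhalf : 0 < (d : ℝ) ^ (s / 2) := Real.rpow_pos_of_pos hdpos _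
  -- Half of the exponent s is given up to absorb the factor 4.
  have hr4 : 4 * r ≤ (d : ℝ) ^ (-(s / 2)) := by
    have e : r = (d : ℝ) ^ (-(s / 2)) * (d : ℝ) ^ (-(s / 2)) := by
      rw [hr, ← Real.rpow_add hdpos]; congr 1; ring
    have h1 : (d : ℝ) ^ (-(s / 2)) ≤ 1 / 8 := by
      rw [Real.rpow_neg hdpos.le, ← one_div]
      exact one_div_le_one_div_of_le (by norm_num) h8
    have h2 : 0 < (d : ℝ) ^ (-(s / 2)) := Real.rpow_pos_of_pos hdpos _
    rw [e]
    nlinarith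
  have hr8 : r ≤ 1 / 8 := by
    have h1 : (d : ℝ) ^ (-(s / 2)) ≤ 1 / 8 := by
      rw [Real.rpow_neg hdpos.le, ← one_div]
      exact one_div_le_one_div_of_le (by norm_num) h8
    linarith
  obtain ⟨m, v, hm, hv, hvr⟩ := SQRCN.exists_almost_orthogonal hd1 hrpos (by linarith)
  set V : ℝ := (d : ℝ) ^ (c * K) with hV
  have hVpos : 0 < V := Real.rpow_pos_of_pos hdpos _
  have hc4 : 4 ≤ (d : ℝ) ^ c := by linarith
  have hVpow : V = ((d : ℝ) ^ c) ^ K := by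
    rw [hV, Real.rpow_mul hdpos.le, Real.rpow_natCast]
  have hVc : (d : ℝ) ^ c ≤ V := by
    rw [hVpow]; exact le_self_pow₀ (by linarith) (by omega)
  have hVK : (K : ℝ) ^ 2 ≤ V := by
    have h1 : (K : ℝ) < 2 ^ K := by exact_mod_cast Nat.lt_two_pow_self
    calc (K : ℝ) ^ 2 ≤ (2 ^ K) ^ 2 := by gcongr
      _ = 4 ^ K := by rw [← pow_mul, mul_comm, pow_mul]; norm_num
      _ ≤ _ := by rw [hVpow]; gcongr
  have hpow : (4 * r) ^ n ≤ (V ^ 4)⁻¹ := by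
    calc (4 * r) ^ n ≤ ((d : ℝ) ^ (-(s / 2))) ^ n := by gcongr
      _ = (d : ℝ) ^ (-(s / 2) * n) := by rw [Real.rpow_mul hdpos.le, Real.rpow_natCast]
      _ ≤ (d : ℝ) ^ (-(4 * (c * K))) := by
          refine Real.rpow_le_rpow_of_exponent_le hd1' ?_
          have h1 : (K : ℝ) ≤ c₀ * n := by exact_mod_cast hKn
          have h2 : 4 * (c * K) = s / 2 * (K / c₀) := by
            rw [hc]; field_simp; norm_num
          have h3 : (K : ℝ) / c₀ ≤ n := by
            rw [div_le_iff₀ (by positivity)]; linarith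
          have h4 := mul_le_mul_of_nonneg_left h3 (half_pos hs0).le
          linarith
      _ = _ := by
          rw [Real.rpow_neg hdpos.le, hV, ← Real.rpow_natCast, ← Real.rpow_mul hdpos.le]
          congr 2
          push_cast
          ring
  have hVG : 4 + 18432 * G ^ 2 ≤ V := hQ.trans hVc
  have hV1 : 1 ≤ V := by linarith
  set y : ℝ := (d : ℝ) ^ (1 - δ) with hy
  have hy2 : 2 ≤ y := hK2.trans hKd
  refine SQRCN.exists_hard_input (by omega) hF hE (hlin d) hv hrpos hr8 hvr
    (τ := G ^ 2 * (V ^ 4)⁻¹) (by gcongr) hVpos (Real.rpow_nonneg (by norm_num) _) ?_ ?_ ?_ ?_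
    hε0.le ?_ P A hA
  · exact (SQRCN.two_mul_div_pow_four_le hVG hKpos hVK).1
  · exact (SQRCN.two_mul_div_pow_four_le hVG hKpos hVK).2
  · have hlog0 := Real.log_nonneg hd1'
    refine SQRCN.budget_lt_card (t := (d : ℝ) ^ (δ / 2)) hy2 hlog hVpos.le ?_ hVK ?_
      (le_trans (le_of_eq ?_) hm)
    · rw [hV, Real.rpow_def_of_pos hdpos, Real.exp_le_exp, mul_comm]
      refine mul_le_mul_of_nonneg_right ?_ hlog0
      exact (mul_le_of_le_one_left hKpos.le hc1).trans hKd
    · rw [Real.rpow_def_of_pos two_pos, Real.exp_le_exp]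
      refine mul_le_of_le_one_left (by linarith) ?_
      linarith [Real.log_two_lt_d9]
    · have e : (d : ℝ) * r ^ 2 = y * (d : ℝ) ^ (δ / 2) := by
        rw [hr, hy, ← Real.rpow_natCast, ← Real.rpow_mul hdpos.le, ← Real.rpow_add hdpos]
        nth_rewrite 1 [← Real.rpow_one (d : ℝ)]
        rw [← Real.rpow_add hdpos]
        congr 1
        rw [hs]
        push_cast
        ring
      rw [e]
  · refine lt_of_le_of_lt hγ (one_div_lt_one_div_of_lt (by positivity) ?_)
    linarith [SQRCN.mul_lt_pow_eight hK2]
  · exact hε.trans (one_div_le_one_div_of_le (by positivity) (SQRCN.mul_lt_pow_eight hK2).le)
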